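/- A context-free grammar $G=\langle N,T,P,S\rangle$ has finitely many productions $A\to\alpha$ with $A\in N$ and $\alpha\in(N\cup T)^+$ (no empty right-hand sides); its size is $|G|=\sum_{A\to\alpha\in P}|A\alpha|$. It is *simple* if every production has the form $A\to a\alpha$ with $a\in T$ and $\alpha\in N^*$, and for all $A\in N$, $a\in T$ there is at most one production of the form $A\to a\alpha$. It is *deterministic* if $L(G)$ is accepted (by final state) by a deterministic push-down automaton. It is *$LL(1)$* if, whenever $S\Rightarrow^* wA\alpha$ is a leftmost derivation with $w\in T^*$, $A\to\beta$ and $A\to\gamma$ are productions, and $\beta\alpha\Rightarrow^* x$, $\gamma\alpha\Rightarrow^* y$ with $x,y\in T^*$ having the same first letter (or both empty), then $\beta=\gamma$. For variables $X_1,\dots,X_n$ with finite domains $D(X_1),\dots,D(X_n)$, the constraint $\mathrm{Grammar}([X_1,\dots,X_n],G)$ holds for an assignment iff the string $X_1X_2\cdots X_n$ belongs to $L(G)$. It is *disentailed* if no assignment with $X_i\in D(X_i)$ for all $i$ satisfies it. **Corollary.** Let $\mathcal C$ be the class of simple grammars, or the class of deterministic grammars, or the class of $LL(1)$ grammars. Then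 detecting disentailment of $\mathrm{Grammar}([X_1,\dots,X_n],G)$ for $G\in\mathcal C$ is at least as hard as context-free parsing of a string of length $n$, up to reductions that are polynomial in the grammar size and linear in $n$. That is: there are constants $c,k$ and an algorithm which, given an arbitrary context-free grammar $H$ and a string $s$ of length $n$, computes in at most $c\,(|H|+1)^k(n+1)$ steps a grammar $G\in\mathcal C$, depending only on $H$, and finite domains $D(X_1),\dots,D(X_n)$ for $n$ variables, such that $$s\in L(H)\iff \mathrm{Grammar}([X_1,\dots,X_n],G)\text{ is not disentailed.}$$ Here an algorithm is a structured program (sequencing, branching, while loops) over finitely many stacks of natural numbers. One step is one elementary instruction (push a constant, pop, copy the top of a stack onto a stack, increment or decrement a top) or one test (is a stack empty; do two stacks have equal tops). Terminals and nonterminals are natural numbers, and grammars, strings and domains are written as sequences of natural numbers, with one number for each symbol and constant overhead for each symbol, production, string and domain. -/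

import Mathlib

namespace GrammarDC

/-! ### Context-free grammars -/

/-- A finite context-free grammar without empty right-hand sides, given by its start symbol and
the list of its productions. Terminals and nonterminals are named by natural numbers (`Symbol`
keeps the two kinds apart). -/
structure CFG where
  start : ℕ
  prods : List (ContextFreeRule ℕ ℕ)
  output_ne_nil : ∀ p ∈ prods, p.output ≠ []

namespace CFG

/-- The same grammar as an object of Mathlib's type of context-free grammars. -/
abbrev toCFG (G : CFG) : ContextFreeGrammar ℕ where
  NT := ℕ
  initial := G.start
  rules := G.prods.toFinset

/-- The language generated by `G`. -/
def language (G : CFG) : Language ℕ := G.toCFG.language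

/-- The size of a grammar: the sum of `|A α|` over all productions `A → α`. -/
def size (G : CFG) : ℕ := (G.prods.map fun p => 1 + p.output.length).sum

/-- Greibach form: every production is `A → a α`, with `a` a terminal and `α` a possibly empty
sequence of nonterminals. -/
def IsGreibach (G : CFG) : Prop :=
  ∀ p ∈ G.prods, ∃ (a : ℕ) (As : List ℕ),
    p.output = Symbol.terminal a :: As.map Symbol.nonterminal

/-- Simple grammars: Greibach form, and for every nonterminal `A` and every terminal `a` at most
one production of the form `A → a α`. -/
def IsSimple (G : CFG) : Prop :=
  G.IsGreibach ∧
    ∀ p ∈ G.prods, ∀ q ∈ G.prods, ∀ a : ℕ, p.input = q.input →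
      p.output.head? = some (Symbol.terminal a) → q.output.head? = some (Symbol.terminal a) →
        p = q

/-- One leftmost derivation step. -/
def LeftStep (G : CFG) (u v : List (Symbol ℕ ℕ)) : Prop :=
  ∃ p ∈ G.prods, ∃ (w : List ℕ) (α : List (Symbol ℕ ℕ)),
    u = w.map Symbol.terminal ++ Symbol.nonterminal p.input :: α ∧
      v = w.map Symbol.terminal ++ (p.output ++ α)

/-- LL(1) grammars: if `S ⇒* w A α` is a leftmost derivation, `A → β` and `A → γ` are
productions, `β α ⇒* x` and `γ α ⇒* y` with terminal strings `x`, `y` that agree on their first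
letter (or are both empty), then `β = γ`. -/
def IsLL1 (G : CFG) : Prop :=
  ∀ (w : List ℕ) (α : List (Symbol ℕ ℕ)), ∀ p ∈ G.prods, ∀ q ∈ G.prods, p.input = q.input →
    Relation.ReflTransGen G.LeftStep [Symbol.nonterminal G.start]
      (w.map Symbol.terminal ++ Symbol.nonterminal p.input :: α) →
    ∀ x y : List ℕ,
      G.toCFG.Derives (p.output ++ α) (x.map Symbol.terminal) →
      G.toCFG.Derives (q.output ++ α) (y.map Symbol.terminal) →
      x.head? = y.head? → p.output = q.output

end CFG

/-! ### Deterministic push-down automata -/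

/-- A deterministic push-down automaton over a finite alphabet of natural numbers.
`δ q (some a) Z` is the move that reads the letter `a`, and `δ q none Z` the move that reads
nothing, in state `q` with `Z` on top of the stack; `Z` is replaced by the returned string. -/
structure DPDA where
  Q : Type
  Γ : Type
  finite_Q : Finite Q
  finite_Γ : Finite Γ
  alphabet : Finset ℕ
  start : Q
  bottom : Γ
  accept : Set Q
  δ : Q → Option ℕ → Γ → Option (Q × List Γ)
  δ_alphabet : ∀ q a Z, a ∉ alphabet → δ q (some a) Z = none
  deterministic : ∀ q Z, δ q none Z ≠ none → ∀ a, δ q (some a) Z = none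

namespace DPDA

/-- One move between configurations (state, remaining input, stack with its top first). -/
inductive Step (M : DPDA) :
    M.Q × List ℕ × List M.Γ → M.Q × List ℕ × List M.Γ → Prop
  | read {q q' : M.Q} {a : ℕ} {w : List ℕ} {Z : M.Γ} {ζ γ : List M.Γ}
      (h : M.δ q (some a) Z = some (q', ζ)) : Step M (q, a :: w, Z :: γ) (q', w, ζ ++ γ)
  | silent {q q' : M.Q} {w : List ℕ} {Z : M.Γ} {ζ γ : List M.Γ}
      (h : M.δ q none Z = some (q', ζ)) : Step M (q, w, Z :: γ) (q', w, ζ ++ γ)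

/-- The language accepted by final state. -/
def language (M : DPDA) : Language ℕ :=
  {w | ∃ (q : M.Q) (γ : List M.Γ), q ∈ M.accept ∧
    Relation.ReflTransGen M.Step (M.start, w, [M.bottom]) (q, [], γ)}

end DPDA

/-- A grammar is deterministic if its language is accepted by a deterministic push-down
automaton. -/
def CFG.IsDeterministic (G : CFG) : Prop := ∃ M : DPDA, M.language = G.language

/-! ### The grammar constraint -/

/-- The constraint `Grammar([X₁, …, Xₙ], G)` holds for an assignment `X` if the string
`X₁ ⋯ Xₙ` belongs to `L(G)`. -/
def GrammarConstraint {n : ℕ} (X : Fin n → ℕ) (G : CFG) : Prop :=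
  List.ofFn X ∈ G.language

/-- `Grammar([X₁, …, Xₙ], G)` is disentailed for the domains `D(X₁), …, D(Xₙ)` (finite sets,
given by lists of their elements) if it has no solution. -/
def Disentailed {n : ℕ} (D : Fin n → List ℕ) (G : CFG) : Prop :=
  ¬ ∃ X : Fin n → ℕ, (∀ i, X i ∈ D i) ∧ GrammarConstraint X G

/-! ### Programs and their running time

The programs work on stacks of natural numbers, finitely many in each program. An elementary
instruction touches only tops of stacks and costs one step. A random access machine carries out
every instruction in constant time, so time bounds for these programs are time bounds for random
access machines too. -/

/-- The tests of a program. -/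
inductive Test
  /-- Is stack `i` empty? -/
  | isEmpty (i : ℕ)
  /-- Do stacks `i` and `j` have the same top (or are both empty)? -/
  | sameTop (i j : ℕ)

/-- The contents of all stacks, tops first. -/
abbrev Store := ℕ → List ℕ

/-- The meaning of a test. -/
def Test.Holds : Test → Store → Prop
  | .isEmpty i, σ => σ i = []
  | .sameTop i j, σ => (σ i).head? = (σ j).head?

/-- Elementary instructions. -/
inductive Instr
  /-- Push the constant `c` on stack `i`. -/
  | push (i c : ℕ)
  /-- Remove the top of stack `i` (no effect if it is empty). -/
  | pop (i : ℕ)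
  /-- Push the top of stack `i` on stack `j` (no effect if stack `i` is empty). -/
  | copy (i j : ℕ)
  /-- Increase the top of stack `i` by one. -/
  | inc (i : ℕ)
  /-- Decrease the top of stack `i` by one, unless it is zero. -/
  | dec (i : ℕ)

/-- The effect of an elementary instruction. -/
def Instr.run : Instr → Store → Store
  | .push i c, σ => Function.update σ i (c :: σ i)
  | .pop i, σ => Function.update σ i (σ i).tail
  | .copy i j, σ => Function.update σ j ((σ i).take 1 ++ σ j)
  | .inc i, σ => Function.update σ i (((σ i).take 1).map (· + 1) ++ (σ i).tail)
  | .dec i, σ => Function.update σ i (((σ i).take 1).map (· - 1) ++ (σ i).tail)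

/-- Structured programs. -/
inductive Prog
  | instr (c : Instr)
  | seq (P Q : Prog)
  | ite (b : Test) (P Q : Prog)
  | while (b : Test) (P : Prog)

/-- `Exec P σ σ' t`: started on `σ`, the program `P` halts with `σ'` after exactly `t` steps, where
every elementary instruction and every evaluation of a test is one step. -/
inductive Exec : Prog → Store → Store → ℕ → Prop
  | instr (c : Instr) (σ : Store) : Exec (.instr c) σ (c.run σ) 1
  | seq {P Q : Prog} {σ σ' σ'' : Store} {t t' : ℕ} :
      Exec P σ σ' t → Exec Q σ' σ'' t' → Exec (.seq P Q) σ σ'' (t + t')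
  | ite_true {b : Test} {P Q : Prog} {σ σ' : Store} {t : ℕ} :
      b.Holds σ → Exec P σ σ' t → Exec (.ite b P Q) σ σ' (t + 1)
  | ite_false {b : Test} {P Q : Prog} {σ σ' : Store} {t : ℕ} :
      ¬ b.Holds σ → Exec Q σ σ' t → Exec (.ite b P Q) σ σ' (t + 1)
  | while_true {b : Test} {P : Prog} {σ σ' σ'' : Store} {t t' : ℕ} :
      b.Holds σ → Exec P σ σ' t → Exec (.while b P) σ' σ'' t' →
        Exec (.while b P) σ σ'' (t + t' + 1)
  | while_false {b : Test} {P : Prog} {σ : Store} :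
      ¬ b.Holds σ → Exec (.while b P) σ σ 1

/-- Started with `input` on stack `0` and all other stacks empty, the program halts within `t`
steps with `output` on stack `1`. -/
def Prog.ComputesWithin (P : Prog) (input output : List ℕ) (t : ℕ) : Prop :=
  ∃ (σ : Store) (t' : ℕ),
    Exec P (Function.update (fun _ => []) 0 input) σ t' ∧ σ 1 = output ∧ t' ≤ t

/-! ### Encodings -/

/-- A list is written element by element, each preceded by `1`, with `0` at the end. -/
def encodeList {α : Type} (f : α → List ℕ) : List α → List ℕ
  | [] => [0]
  | x :: l => 1 :: (f x ++ encodeList f l)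

/-- The encoding of a string of letters, or of a finite set given by a list. -/
def encodeString (s : List ℕ) : List ℕ := encodeList (fun a => [a]) s

/-- The encoding of a terminal or nonterminal. -/
def encodeSymbol : Symbol ℕ ℕ → List ℕ
  | .terminal a => [0, a]
  | .nonterminal A => [1, A]

/-- The encoding of a production. -/
def encodeRule (p : ContextFreeRule ℕ ℕ) : List ℕ :=
  p.input :: encodeList encodeSymbol p.output

/-- The encoding of a grammar. -/
def encodeGrammar (G : CFG) : List ℕ := G.start :: encodeList encodeRule G.prods

/-- The encoding of the domains of `n` variables. -/
def encodeDomains {n : ℕ} (D : Fin n → List ℕ) : List ℕ := encodeList encodeString (List.ofFn D)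

/-! ### The reduction -/

/-- Context-free parsing (given a grammar `H` and a string `s`, is `s ∈ L(H)`?) reduces to detecting
disentailment of `Grammar([X₁, …, Xₙ], G)` for grammars `G` of the class `C`, by a reduction
that is polynomial in the size of the grammar and linear in `n`: one program transforms every
`(H, s)`, with `s` of length `n`, into a grammar `gram H` of the class, which depends on `H` only,
and domains for `n` variables, in time `O((|H| + 1) ^ k * (n + 1))`. -/
def ParsingReducesToDisentailment (C : CFG → Prop) : Prop :=
  ∃ (P : Prog) (c k : ℕ) (gram : CFG → CFG)
    (dom : CFG → (s : List ℕ) → Fin s.length → List ℕ),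
    ∀ (H : CFG) (s : List ℕ),
      C (gram H) ∧
      (s ∈ H.language ↔ ¬ Disentailed (dom H s) (gram H)) ∧
      P.ComputesWithin (encodeGrammar H ++ encodeString s)
        (encodeGrammar (gram H) ++ encodeDomains (dom H s))
        (c * (H.size + 1) ^ k * (s.length + 1))

end GrammarDC

/-!
The reduction maps a grammar `H` to a Greibach normal form in which every production starts with a
terminal of its own, namely its number in the list of productions. Such a grammar is simple for a
trivial reason, and simple grammars are `LL(1)` (`CFG.IsSimple.isLL1`) and deterministic
(`CFG.IsSimple.isDeterministic`), so that one reduction serves all three classes. The domain of a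
variable undoes the renaming of terminals: for the letter `a` it consists of the numbers of all
productions that had the terminal `a` before. Hence an assignment from the domains that satisfies
the constraint is the same as a derivation of the given string
(`CFG.mem_language_iff_not_disentailed`).

The normal form has to be computed in polynomial time, so the productions cannot be expanded one
into the other. First, right-hand sides are cut down to length one and two (`Tables`,
`CFG.gen_tables_iff`). Then derivation trees are read along their leftmost branches: for nodes `A`
and `X`, let `Corner A X` be the language of all words that complete an `X` in the lower left corner
of a tree to the whole tree of `A`. A non-empty word of `Corner A X` starts at the lowest binary
production `C → X' Y` on the branch with a chain of unit productions from `X'` to `X`; it consists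
of a word of `Y`, that is a letter `a` and a word of `Corner Y a` (`Tables.Gen.exists_corner`,
`Tables.Corner.gen`), and of a word of `Corner A C`. This is a production of Greibach form for the
nonterminal `(A, X)`, with at most two nonterminals behind `a`. References to the empty word, which
belongs to `Corner A X` if there is a chain of unit productions, are resolved by leaving out the
nonterminal. The number of productions is polynomial in the size of `H`.

For the running time, lists of numbers are described by comprehensions (`Expr`): concatenation,
tests, iteration over the blocks of a list, local definitions, and iteration of a step that does not
produce lists longer than a given one. They are compiled into programs on stacks, and each
comprehension takes time polynomial in the lengths of the lists that it reads
(`Expr.exists_compilesWithin`). The normal form, its encoding, and the encoding of a domain are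
given by comprehensions; a short program reads the grammar beforehand (`runs_readGrammar`), and
another one evaluates the comprehension of the domain once for each letter (`runs_writeDomains`),
which makes the time linear in the length of the string (`exists_reduction_computesWithin`).
-/

namespace GrammarDC

/-! ### Running times up to upper bounds -/

/-- The program `P` turns `σ` into `σ'` within `t` steps. -/
def Runs (P : Prog) (σ σ' : Store) (t : ℕ) : Prop := ∃ t' ≤ t, Exec P σ σ' t'

namespace Runs

variable {P Q : Prog} {σ σ' σ'' : Store} {t t' : ℕ}

theorem mono (h : Runs P σ σ' t) (ht : t ≤ t') : Runs P σ σ' t' :=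
  let ⟨u, hu, e⟩ := h
  ⟨u, hu.trans ht, e⟩

theorem cast (h : Runs P σ σ' t) (hs : σ' = σ'') (ht : t ≤ t') : Runs P σ σ'' t' :=
  hs ▸ h.mono ht

theorem instr (c : Instr) (σ : Store) : Runs (.instr c) σ (c.run σ) 1 :=
  ⟨1, le_rfl, .instr c σ⟩

theorem seq (h : Runs P σ σ' t) (h' : Runs Q σ' σ'' t') : Runs (.seq P Q) σ σ'' (t + t') :=
  let ⟨u, hu, e⟩ := h
  let ⟨u', hu', e'⟩ := h'
  ⟨u + u', by omega, .seq e e'⟩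

theorem ite_true {b : Test} (hb : b.Holds σ) (h : Runs P σ σ' t) :
    Runs (.ite b P Q) σ σ' (t + 1) :=
  let ⟨u, hu, e⟩ := h
  ⟨u + 1, by omega, .ite_true hb e⟩

theorem ite_false {b : Test} (hb : ¬ b.Holds σ) (h : Runs Q σ σ' t) :
    Runs (.ite b P Q) σ σ' (t + 1) :=
  let ⟨u, hu, e⟩ := h
  ⟨u + 1, by omega, .ite_false hb e⟩

theorem while_true {b : Test} (hb : b.Holds σ) (h : Runs P σ σ' t)
    (h' : Runs (.while b P) σ' σ'' t') : Runs (.while b P) σ σ'' (t + t' + 1) :=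
  let ⟨u, hu, e⟩ := h
  let ⟨u', hu', e'⟩ := h'
  ⟨u + u' + 1, by omega, .while_true hb e e'⟩

theorem while_false {b : Test} (hb : ¬ b.Holds σ) : Runs (.while b P) σ σ 1 :=
  ⟨1, le_rfl, .while_false hb⟩

end Runs

/-! ### Loops over the elements of a stack -/

/-- Sequencing of programs. -/
infixr:60 " ;; " => Prog.seq

/-- Run `body` as long as stack `w` is not empty. There is no test for non-emptiness, so the loop
is controlled by stacks `2` and `3`: they are empty before and after every round, and a `0` on
stack `2` ends the loop. -/
def whileNonempty (w : ℕ) (body : Prog) : Prog :=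
  .while (.sameTop 2 3) (.ite (.isEmpty w) (.instr (.push 2 0)) body) ;; .instr (.pop 2)

/-- Stacks `2` and `3`, which control the loops, are empty. -/
def Ready (σ : Store) : Prop := σ 2 = [] ∧ σ 3 = []

theorem Ready.update {σ : Store} (h : Ready σ) {i : ℕ} (hi : 4 ≤ i) (l : List ℕ) :
    Ready (Function.update σ i l) := by
  refine ⟨?_, ?_⟩
  · rw [Function.update_of_ne (by omega)]; exact h.1
  · rw [Function.update_of_ne (by omega)]; exact h.2

/-- The loop rule: `s j` is the store after `j` rounds. -/
theorem Runs.whileNonempty {w : ℕ} {body : Prog} {τ : ℕ} (n : ℕ) (s : ℕ → Store)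
    (hs : ∀ j ≤ n, Ready (s j)) (hne : ∀ j < n, s j w ≠ []) (hn : s n w = [])
    (hbody : ∀ j < n, Runs body (s j) (s (j + 1)) τ) :
    Runs (whileNonempty w body) (s 0) (s n) (n * (τ + 2) + 5) := by
  have core : Runs (.while (.sameTop 2 3) (.ite (.isEmpty w) (.instr (.push 2 0)) body))
      (s 0) (Function.update (s n) 2 [0]) (n * (τ + 2) + 4) := by
    induction n generalizing s with
    | zero =>
      have h := hs 0 le_rfl
      refine (Runs.while_true (b := .sameTop 2 3) (t' := 1) ?_
        (Runs.ite_true (b := .isEmpty w) hn (Runs.instr (.push 2 0) _)) ?_).cast rfl (by omega)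
      · simp [Test.Holds, h.1, h.2]
      · have : Instr.run (.push 2 0) (s 0) = Function.update (s 0) 2 [0] := by
          simp [Instr.run, h.1]
        rw [this]
        exact Runs.while_false (by simp [Test.Holds, h.2])
    | succ n ih =>
      have h := hs 0 (Nat.zero_le _)
      have := ih (fun j => s (j + 1)) (fun j hj => hs _ (by omega)) (fun j hj => hne _ (by omega))
        hn (fun j hj => hbody _ (by omega))
      refine (Runs.while_true (b := .sameTop 2 3) ?_
        (Runs.ite_false (b := .isEmpty w) (hne 0 (by omega)) (hbody 0 (by omega))) this).cast rfl
        (by rw [Nat.succ_mul]; omega)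
      simp [Test.Holds, h.1, h.2]
  refine (core.seq (Runs.instr (.pop 2) _)).cast ?_ le_rfl
  have h := hs n le_rfl
  simp [Instr.run, ← h.1]

/-- Move the elements of stack `x` one by one to stack `y`, which reverses their order. -/
def move (x y : ℕ) : Prog :=
  whileNonempty x (.instr (.copy x y) ;; .instr (.pop x))

theorem take_one_drop {l : List ℕ} {j : ℕ} (hj : j < l.length) :
    (l.drop j).take 1 = [l[j]] := by
  rw [List.drop_eq_getElem_cons hj]; rfl

theorem reverse_take_succ {l : List ℕ} {j : ℕ} (hj : j < l.length) :
    (l.take (j + 1)).reverse = l[j] :: (l.take j).reverse := by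
  rw [List.take_succ_eq_append_getElem hj]; simp

theorem Runs.move {x y : ℕ} (hx : 4 ≤ x) (hy : y = 1 ∨ 4 ≤ y) (hxy : x ≠ y) {σ : Store}
    (hσ : Ready σ) :
    Runs (move x y) σ
      (Function.update (Function.update σ x []) y ((σ x).reverse ++ σ y))
      ((σ x).length * 4 + 5) := by
  have := Runs.whileNonempty (w := x) (body := .instr (.copy x y) ;; .instr (.pop x)) (τ := 2)
    (σ x).length
    (fun j => Function.update (Function.update σ x ((σ x).drop j)) y
      (((σ x).take j).reverse ++ σ y)) ?_ ?_ ?_ ?_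
  · simp only [List.drop_zero, Function.update_eq_self, List.take_zero, List.reverse_nil,
      List.nil_append, List.drop_length, List.take_length] at this
    exact this
  · intro j _
    refine ⟨?_, ?_⟩
    · rw [Function.update_of_ne (by omega), Function.update_of_ne (by omega)]; exact hσ.1
    · rw [Function.update_of_ne (by omega), Function.update_of_ne (by omega)]; exact hσ.2
  · intro j hj
    simp [Function.update_of_ne hxy, hj]
  · simp [Function.update_of_ne hxy]
  · intro j hj
    refine ((Runs.instr (.copy x y) _).seq (Runs.instr (.pop x) _)).cast ?_ le_rfl
    have h1 := take_one_drop hj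
    have h2 := reverse_take_succ hj
    funext z
    simp only [Instr.run, Function.update_apply, h2]
    split_ifs <;> simp_all

/-- Empty stack `x`. -/
def clear (x : ℕ) : Prog := whileNonempty x (.instr (.pop x))

theorem Runs.clear {x : ℕ} (hx : 4 ≤ x) {σ : Store} (hσ : Ready σ) :
    Runs (clear x) σ (Function.update σ x []) ((σ x).length * 3 + 5) := by
  have := Runs.whileNonempty (w := x) (body := .instr (.pop x)) (τ := 1) (σ x).length
    (fun j => Function.update σ x ((σ x).drop j)) ?_ ?_ ?_ ?_
  · simp only [List.drop_zero, Function.update_eq_self, List.drop_length] at this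
    exact this
  · exact fun j _ => hσ.update hx _
  · intro j hj
    simp [hj]
  · simp
  · intro j hj
    refine (Runs.instr (.pop x) _).cast ?_ le_rfl
    simp [Instr.run]

/-- Copy stack `x` to the empty stack `y`, with the help of the empty stack `z`. -/
def dup (x y z : ℕ) : Prog :=
  move x z ;;
    whileNonempty z (.instr (.copy z x) ;; .instr (.copy z y) ;; .instr (.pop z))

theorem Runs.dup {x y z : ℕ} (hx : 4 ≤ x) (hy : 4 ≤ y) (hz : 4 ≤ z) (hxy : x ≠ y) (hxz : x ≠ z)
    (hyz : y ≠ z) {σ : Store} (hσ : Ready σ) (hσy : σ y = []) (hσz : σ z = []) :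
    Runs (dup x y z) σ (Function.update σ y (σ x)) ((σ x).length * 9 + 10) := by
  have h1 := Runs.move hx (Or.inr hz) hxz hσ
  obtain ⟨l, hl⟩ : ∃ l : List ℕ, σ x = l.reverse := ⟨_, (List.reverse_reverse _).symm⟩
  rw [hl, List.reverse_reverse, List.length_reverse, hσz, List.append_nil] at h1
  rw [hl, List.length_reverse]
  let s : ℕ → Store := fun j => Function.update (Function.update (Function.update σ x
    ((l.take j).reverse)) y ((l.take j).reverse)) z (l.drop j)
  have h2 := Runs.whileNonempty (w := z)
    (body := .instr (.copy z x) ;; .instr (.copy z y) ;; .instr (.pop z)) (τ := 3)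
    l.length s ?_ ?_ ?_ ?_
  · have e0 : Function.update (Function.update σ x []) z l = s 0 := by
      funext i
      simp only [s, Function.update_apply]
      split_ifs <;> simp_all
    have e1 : s l.length = Function.update σ y l.reverse := by
      funext i
      simp only [s, Function.update_apply]
      split_ifs <;> simp_all
    rw [e0] at h1
    exact (h1.seq h2).cast e1 (by omega)
  · exact fun j _ => ((hσ.update hx _).update hy _).update hz _
  · intro j hj
    simp [s, hj]
  · simp [s]
  · intro j hj
    refine (((Runs.instr (.copy z x) _).seq ((Runs.instr (.copy z y) _).seq
      (Runs.instr (.pop z) _)))).cast ?_ le_rfl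
    have h1 := take_one_drop hj
    have h2 := reverse_take_succ hj
    funext i
    simp only [Instr.run, Function.update_apply, s, h2]
    split_ifs <;> simp_all

/-! ### Polynomial bounds -/

/-- The function `p` is bounded by a polynomial. -/
def Poly (p : ℕ → ℕ) : Prop := ∃ c k, ∀ n, p n ≤ c * (n + 1) ^ k

namespace Poly

variable {p q : ℕ → ℕ}

theorem const (a : ℕ) : Poly fun _ => a := ⟨a, 0, by simp⟩

theorem id : Poly fun n => n := ⟨1, 1, by simp⟩

theorem add (hp : Poly p) (hq : Poly q) : Poly fun n => p n + q n := by
  obtain ⟨c, k, h⟩ := hp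
  obtain ⟨c', k', h'⟩ := hq
  refine ⟨c + c', k + k', fun n => ?_⟩
  have h1 : (n + 1) ^ k ≤ (n + 1) ^ (k + k') := Nat.pow_le_pow_right (by omega) (by omega)
  have h2 : (n + 1) ^ k' ≤ (n + 1) ^ (k + k') := Nat.pow_le_pow_right (by omega) (by omega)
  calc p n + q n ≤ c * (n + 1) ^ k + c' * (n + 1) ^ k' := add_le_add (h n) (h' n)
    _ ≤ c * (n + 1) ^ (k + k') + c' * (n + 1) ^ (k + k') := by gcongr
    _ = _ := by ring

theorem mul (hp : Poly p) (hq : Poly q) : Poly fun n => p n * q n := by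
  obtain ⟨c, k, h⟩ := hp
  obtain ⟨c', k', h'⟩ := hq
  refine ⟨c * c', k + k', fun n => ?_⟩
  calc p n * q n ≤ (c * (n + 1) ^ k) * (c' * (n + 1) ^ k') := Nat.mul_le_mul (h n) (h' n)
    _ = _ := by ring

theorem comp (hp : Poly p) (hq : Poly q) : Poly fun n => p (q n) := by
  obtain ⟨c, k, h⟩ := hp
  obtain ⟨c', k', h'⟩ := hq
  refine ⟨c * (c' + 1) ^ k, k' * k, fun n => (h _).trans ?_⟩
  have h1 : 1 ≤ (n + 1) ^ k' := Nat.one_le_pow _ _ (by omega)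
  calc c * (q n + 1) ^ k ≤ c * ((c' + 1) * (n + 1) ^ k') ^ k := by
        gcongr
        have := h' n
        nlinarith
    _ = _ := by rw [mul_pow, ← pow_mul]; ring

end Poly

/-! ### A language of list comprehensions -/

/-- Expressions that denote lists of natural numbers. Variables are stacks; each binder names a
stack `d` from which on the stacks are free for its own use. -/
inductive Expr
  /-- The empty list. -/
  | nil
  /-- The list with the single element `c`. -/
  | const (c : ℕ)
  /-- The list that holds the first element of the variable `x`, if there is one. -/
  | hd (x : ℕ)
  | app (e₁ e₂ : Expr)
  | ite (b : Test) (e₁ e₂ : Expr)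
  /-- Cut `x` into blocks of length `k` and concatenate the values of `e` for all blocks; `e`
  finds the number of the block in `d + 1` and its entries in `d + 2`, …, `d + 1 + k`. -/
  | each (d k x : ℕ) (e : Expr)
  /-- The value of `e₂` with the value of `e₁` in the variable `d + 1`. -/
  | bind (d : ℕ) (e₁ e₂ : Expr)
  /-- Replace the empty list by the value of `e`, in which the variable `d + 2` holds the old
  list, as many times as `x` has elements. -/
  | iter (d x : ℕ) (e : Expr)

/-- The variables of a test satisfy `A`. -/
def Test.Reads (A : ℕ → Prop) : Test → Prop
  | .isEmpty i => A i
  | .sameTop i j => A i ∧ A j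

theorem Test.holds_congr {A : ℕ → Prop} {b : Test} (hb : b.Reads A) {σ τ : Store}
    (h : ∀ x, A x → σ x = τ x) : b.Holds σ ↔ b.Holds τ := by
  cases b with
  | isEmpty i => simp [Test.Holds, h i hb]
  | sameTop i j => simp [Test.Holds, h i hb.1, h j hb.2]

/-- The store in which block number `j` with the entries `c` is bound at `d`: `j` is in `d + 1`, the
entries are in `d + 2`, `d + 3`, …, and all stacks above them are empty. -/
def bindBlock (σ : Store) (d j : ℕ) (c : List ℕ) : Store := fun y =>
  if y = d + 1 then [j] else if d + 2 ≤ y then (c.drop (y - (d + 2))).take 1 else σ y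

instance (b : Test) (σ : Store) : Decidable (b.Holds σ) := by
  cases b <;> unfold Test.Holds <;> infer_instance

namespace Expr

/-- The value of an expression. -/
def eval : Expr → Store → List ℕ
  | nil, _ => []
  | const c, _ => [c]
  | hd x, σ => (σ x).take 1
  | app e₁ e₂, σ => e₁.eval σ ++ e₂.eval σ
  | ite b e₁ e₂, σ => if b.Holds σ then e₁.eval σ else e₂.eval σ
  | each d k x e, σ => (List.range (((σ x).length + k - 1) / k)).flatMap fun j =>
      e.eval (bindBlock σ d j (((σ x).drop (j * k)).take k))
  | bind d e₁ e₂, σ => e₂.eval (Function.update σ (d + 1) (e₁.eval σ))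
  | iter d x e, σ => (fun T => e.eval (Function.update σ (d + 2) T))^[(σ x).length] []

/-- The expression reads only variables in `A`, and uses only stacks from `m` on for its binders.
The values in an iteration must not grow beyond the list that counts the rounds; this keeps them
of polynomial size. -/
def Ok : Expr → (ℕ → Prop) → ℕ → Prop
  | nil, _, _ => True
  | const _, _, _ => True
  | hd x, A, _ => A x
  | app e₁ e₂, A, m => e₁.Ok A m ∧ e₂.Ok A m
  | ite b e₁ e₂, A, m => b.Reads A ∧ e₁.Ok A m ∧ e₂.Ok A m
  | each d k x e, A, m => m ≤ d ∧ 1 ≤ k ∧ A x ∧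
      e.Ok (fun y => A y ∨ (d + 1 ≤ y ∧ y < d + 2 + k)) (d + 2 + k)
  | bind d e₁ e₂, A, m => m ≤ d ∧ e₁.Ok A (d + 1) ∧ e₂.Ok (fun y => A y ∨ y = d + 1) (d + 2)
  | iter d x e, A, m => m ≤ d ∧ A x ∧ e.Ok (fun y => A y ∨ y = d + 2) (d + 3) ∧
      ∀ σ, (e.eval σ).length ≤ (σ x).length

theorem eval_congr {e : Expr} {A : ℕ → Prop} {m : ℕ} (he : e.Ok A m) {σ τ : Store}
    (h : ∀ x, A x → σ x = τ x) : e.eval σ = e.eval τ := by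
  induction e generalizing A m σ τ with
  | nil => rfl
  | const c => rfl
  | hd x => simp [eval, h x he]
  | app e₁ e₂ ih₁ ih₂ => simp [eval, ih₁ he.1 h, ih₂ he.2 h]
  | ite b e₁ e₂ ih₁ ih₂ =>
    simp only [eval, ih₁ he.2.1 h, ih₂ he.2.2 h]
    exact if_congr (Test.holds_congr he.1 h) rfl rfl
  | each d k x e ih =>
    obtain ⟨_, _, hx, he⟩ := he
    simp only [eval, h x hx]
    congr 1
    funext j
    refine ih he fun y hy => ?_
    unfold bindBlock
    split_ifs
    · rfl
    · rfl
    · exact h y (hy.resolve_right (by omega))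
  | bind d e₁ e₂ ih₁ ih₂ =>
    obtain ⟨_, h₁, h₂⟩ := he
    simp only [eval, ih₁ h₁ h]
    refine ih₂ h₂ fun y hy => ?_
    simp only [Function.update_apply]
    split_ifs
    · rfl
    · exact h y (by tauto)
  | iter d x e ih =>
    obtain ⟨_, hx, he, _⟩ := he
    simp only [eval, h x hx]
    congr 1
    funext T
    refine ih he fun y hy => ?_
    simp only [Function.update_apply]
    split_ifs
    · rfl
    · exact h y (by tauto)

end Expr

/-! ### Compilation of comprehensions -/

/-- A program without effect if stack `2` is empty. -/
def skip : Prog := .instr (.pop 2)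

/-- Move the first `k` elements of stack `w` to the stacks `v`, …, `v + k - 1`. -/
def load (w : ℕ) : ℕ → ℕ → Prog
  | _, 0 => skip
  | v, k + 1 => .instr (.copy w v) ;; .instr (.pop w) ;; load w (v + 1) k

/-- Remove the tops of the stacks `v`, …, `v + k - 1`. -/
def unload : ℕ → ℕ → Prog
  | _, 0 => skip
  | v, k + 1 => .instr (.pop v) ;; unload (v + 1) k

theorem Runs.skip {σ : Store} (h : Ready σ) : Runs skip σ σ 1 :=
  (Runs.instr (.pop 2) σ).cast (by
    rw [Instr.run, h.1, List.tail_nil, ← h.1, Function.update_eq_self]) le_rfl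

theorem Runs.load {w v k : ℕ} (hw : 4 ≤ w) (hv : w < v) {σ : Store} (hσ : Ready σ)
    (he : ∀ y, v ≤ y → y < v + k → σ y = []) :
    Runs (load w v k) σ (fun y => if y = w then (σ w).drop k else
      if v ≤ y ∧ y < v + k then ((σ w).drop (y - v)).take 1 else σ y) (2 * k + 1) := by
  induction k generalizing v σ with
  | zero =>
    refine (Runs.skip hσ).cast ?_ (by omega)
    funext y
    split_ifs with h1 h2
    · simp [h1]
    · omega
    · rfl
  | succ k ih =>
    have hr : Ready (Instr.run (.pop w) (Instr.run (.copy w v) σ)) :=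
      (hσ.update (by omega) _).update hw _
    have := ih (v := v + 1) (by omega) hr (fun y h1 h2 => by
      simp only [Instr.run]
      rw [Function.update_of_ne (by omega), Function.update_of_ne (by omega)]
      exact he y (by omega) (by omega))
    refine ((Runs.instr (.copy w v) σ).seq ((Runs.instr (.pop w) _).seq this)).cast ?_ (by omega)
    have hv' := he v le_rfl (by omega)
    funext y
    simp only [Instr.run, Function.update_apply]
    by_cases h1 : y = w
    · subst h1
      rw [if_pos rfl, if_pos rfl]
      simp only [if_pos, if_neg hv.ne]
      rw [← List.drop_one, List.drop_drop, add_comm]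
    · rw [if_neg h1, if_neg h1]
      by_cases h2 : y = v
      · subst h2
        rw [if_neg (by omega), if_neg h1, if_pos rfl, if_pos (by omega), hv']
        simp
      · simp only [if_pos, if_neg hv.ne, if_neg h1, if_neg h2]
        by_cases h3 : v + 1 ≤ y ∧ y < v + 1 + k
        · rw [if_pos h3, if_pos (by omega), ← List.drop_one, List.drop_drop]
          congr 2
          omega
        · rw [if_neg h3, if_neg (by omega)]

theorem Runs.unload {v k : ℕ} (hv : 4 ≤ v) {σ : Store} (hσ : Ready σ) :
    Runs (unload v k) σ (fun y => if v ≤ y ∧ y < v + k then (σ y).tail else σ y) (k + 1) := by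
  induction k generalizing v σ with
  | zero =>
    refine (Runs.skip hσ).cast ?_ (by omega)
    funext y
    rw [if_neg (by omega)]
  | succ k ih =>
    have := ih (v := v + 1) (by omega) (hσ.update hv (σ v).tail)
    refine ((Runs.instr (.pop v) σ).seq this).cast ?_ (by omega)
    funext y
    simp only [Function.update_apply]
    by_cases h2 : y = v
    · subst h2
      rw [if_neg (by omega), if_pos rfl, if_pos (by omega)]
    · simp only [if_neg h2]
      split_ifs <;> first | rfl | omega

namespace Expr

/-- A program that pushes the elements of the value of the expression one by one on stack `r`. The
loops of `each` and `iter` consume a copy of the variable in stack `d`; `bind` and `iter` collect a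
value in reverse on one stack and turn it round by moving it to the next one. -/
def compile : Expr → ℕ → Prog
  | nil, _ => skip
  | const c, r => .instr (.push r c)
  | hd x, r => .instr (.copy x r)
  | app e₁ e₂, r => e₁.compile r ;; e₂.compile r
  | ite b e₁ e₂, r => .ite b (e₁.compile r) (e₂.compile r)
  | each d k x e, r =>
      dup x d (d + 1) ;; .instr (.push (d + 1) 0) ;;
      whileNonempty d (load d (d + 2) k ;; e.compile r ;; unload (d + 2) k ;;
        .instr (.inc (d + 1))) ;;
      .instr (.pop (d + 1))
  | bind d e₁ e₂, r => e₁.compile d ;; move d (d + 1) ;; e₂.compile r ;; clear (d + 1)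
  | iter d x e, r =>
      dup x d (d + 1) ;;
      whileNonempty d (.instr (.pop d) ;; e.compile (d + 1) ;; clear (d + 2) ;;
        move (d + 1) (d + 2)) ;;
      move (d + 2) r

end Expr

theorem bindBlock_of_lt {σ : Store} {d j : ℕ} {c : List ℕ} {y : ℕ} (h : y < d + 1) :
    bindBlock σ d j c y = σ y := by
  unfold bindBlock
  rw [if_neg (by omega), if_neg (by omega)]

namespace Expr

/-- The compiled expression runs correctly from `σ`, and both its value and its running time are
at most `t`. -/
def RunsWithin (e : Expr) (r : ℕ) (σ : Store) (t : ℕ) : Prop :=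
  (e.eval σ).length ≤ t ∧
    Runs (e.compile r) σ (Function.update σ r ((e.eval σ).reverse ++ σ r)) t

/-- The expression is compiled correctly, and its running time is at most `p L` if all lists that
it reads have length at most `L`. The stacks from `m` on have to be empty, and the stack `r` that
receives the value must not be among the variables `A`. -/
def CompilesWithin (e : Expr) (A : ℕ → Prop) (m : ℕ) (p : ℕ → ℕ) : Prop :=
  ∀ L σ r, (∀ x, A x → (σ x).length ≤ L) → Ready σ → (∀ i, m ≤ i → σ i = []) → 4 ≤ r → r < m →
    ¬ A r → e.RunsWithin r σ (p L)

theorem compilesWithin_each {d k x : ℕ} {e : Expr} {A : ℕ → Prop} {m : ℕ}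
    (he : (each d k x e).Ok A m) (hA : ∀ x, A x → 4 ≤ x ∧ x < m) {p : ℕ → ℕ}
    (h : e.CompilesWithin (fun y => A y ∨ (d + 1 ≤ y ∧ y < d + 2 + k)) (d + 2 + k) p) :
    (each d k x e).CompilesWithin A m
      fun L => L * (p (L + 1) + 3 * k + 5) + L * 9 + 20 := by
  obtain ⟨hmd, hk, hx, he⟩ := he
  intro L σ r hL hσ hm hr4 hrm hr
  beta_reduce
  have hx4 := hA x hx
  set l := σ x with hl
  set n := (l.length + k - 1) / k with hn
  set f : ℕ → List ℕ := fun j => e.eval (bindBlock σ d j ((l.drop (j * k)).take k)) with hf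
  have hval : (each d k x e).eval σ = (List.range n).flatMap f := by
    simp only [eval, hl, hn, hf]
  have hlt : ∀ j < n, j * k < l.length := by
    intro j hj
    have h1 : (j + 1) * k ≤ l.length + k - 1 := by
      calc (j + 1) * k ≤ n * k := Nat.mul_le_mul_right _ hj
        _ ≤ _ := Nat.div_mul_le_self _ _
    rw [add_mul] at h1
    omega
  have hnk : l.length ≤ n * k := by
    have h1 := Nat.div_add_mod (l.length + k - 1) k
    have h2 := Nat.mod_lt (l.length + k - 1) hk
    rw [mul_comm, ← hn] at h1
    omega
  have hnL : n ≤ L := by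
    have h1 : n ≤ l.length := by
      by_contra h1
      have h2 := hlt l.length (by omega)
      have := Nat.le_mul_of_pos_right l.length hk
      omega
    exact h1.trans (hL x hx)
  -- The store after `j` rounds: the remaining blocks, the number of the next block, and the value
  -- collected so far.
  let s : ℕ → Store := fun j => Function.update (Function.update (Function.update σ d
    (l.drop (j * k))) (d + 1) [j]) r (((List.range j).flatMap f).reverse ++ σ r)
  have hsr : ∀ j, Ready (s j) := fun j =>
    ((hσ.update (by omega) _).update (by omega) _).update hr4 _
  have hround : ∀ j < n, (f j).length ≤ p (L + 1) ∧
      Runs (load d (d + 2) k ;; e.compile r ;; unload (d + 2) k ;; .instr (.inc (d + 1)))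
        (s j) (s (j + 1)) (p (L + 1) + 3 * k + 3) := by
    intro j hj
    have h1 := Runs.load (w := d) (v := d + 2) (k := k) (by omega) (by omega) (hsr j)
      (fun y h1 h2 => by
        simp only [s]
        rw [Function.update_of_ne (by omega), Function.update_of_ne (by omega),
          Function.update_of_ne (by omega)]
        exact hm y (by omega))
    -- The store after the block is loaded; it agrees with `bindBlock` on the variables of `e`.
    set τ : Store := fun y => if y = d then ((s j) d).drop k else
      if d + 2 ≤ y ∧ y < d + 2 + k then (((s j) d).drop (y - (d + 2))).take 1 else s j y with hτ
    have hsd : s j d = l.drop (j * k) := by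
      simp only [s]
      rw [Function.update_of_ne (by omega), Function.update_of_ne (by omega),
        Function.update_self]
    have hτA : ∀ y, (A y ∨ (d + 1 ≤ y ∧ y < d + 2 + k)) →
        τ y = bindBlock σ d j ((l.drop (j * k)).take k) y := by
      intro y hy
      simp only [hτ, hsd, bindBlock]
      rcases hy with hy | hy
      · have := hA y hy
        have : y ≠ r := fun h => hr (h ▸ hy)
        rw [if_neg (by omega), if_neg (by omega), if_neg (by omega), if_neg (by omega)]
        simp only [s]
        rw [Function.update_of_ne this, Function.update_of_ne (by omega),
          Function.update_of_ne (by omega)]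
      · rw [if_neg (by omega)]
        by_cases h2 : y = d + 1
        · rw [if_neg (by omega), if_pos h2]
          simp only [s]
          rw [Function.update_of_ne (by omega), h2, Function.update_self]
        · rw [if_pos (by omega), if_neg h2, if_pos (by omega), List.drop_take, List.take_take]
          congr 1
          omega
    have hfj : e.eval τ = f j := eval_congr he hτA
    have hτr : τ r = ((List.range j).flatMap f).reverse ++ σ r := by
      simp only [hτ]
      rw [if_neg (by omega), if_neg (by omega)]
      simp [s]
    have hτR : Ready τ := by
      refine ⟨?_, ?_⟩ <;> simp only [hτ] <;> rw [if_neg (by omega), if_neg (by omega)]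
      exacts [(hsr j).1, (hsr j).2]
    have h2 := h (L + 1) τ r ?_ hτR ?_ hr4 (by omega) ?_
    · rw [RunsWithin, hfj] at h2
      refine ⟨h2.1, ?_⟩
      have hR2 := hτR.update hr4 ((f j).reverse ++ τ r)
      have h3 := Runs.unload (v := d + 2) (k := k) (by omega) hR2
      refine (h1.seq (h2.2.seq (h3.seq (Runs.instr (.inc (d + 1)) _)))).cast ?_ (by omega)
      funext y
      rw [hτr]
      simp only [Instr.run, Function.update_apply]
      by_cases h4 : y = d + 1
      · rw [if_pos h4, if_neg (by omega), if_neg (by omega)]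
        simp only [hτ, s]
        rw [if_neg (by omega), if_neg (by omega), Function.update_of_ne (by omega),
          Function.update_self, Function.update_of_ne (by omega), h4, Function.update_self]
        rfl
      · rw [if_neg h4]
        by_cases h5 : y = r
        · rw [if_neg (by omega), if_pos h5]
          simp only [s, h5, Function.update_self, List.range_succ, List.flatMap_append,
            List.flatMap_singleton, List.reverse_append, List.append_assoc]
        · rw [if_neg h5]
          simp only [s, Function.update_apply, if_neg h5, if_neg h4]
          by_cases h6 : y = d
          · rw [if_neg (by omega), if_pos h6]
            simp only [hτ]
            rw [if_pos h6, hsd, List.drop_drop, add_mul, one_mul]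
          · rw [if_neg h6]
            simp only [hτ, hsd]
            rw [if_neg h6]
            by_cases h7 : d + 2 ≤ y ∧ y < d + 2 + k
            · rw [if_pos h7, if_pos h7, hm y (by omega)]
              apply List.eq_nil_of_length_eq_zero
              simp only [List.length_tail, List.length_take]
              omega
            · rw [if_neg h7, if_neg h7]
              simp only [s, Function.update_apply, if_neg h5, if_neg h4, if_neg h6]
    · intro y hy
      rw [hτA y hy]
      unfold bindBlock
      split_ifs with h3 h4
      · simp
      · simp only [List.length_take]; omega
      · exact (hL y (hy.resolve_right (by omega))).trans (by omega)
    · intro y hy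
      simp only [hτ]
      rw [if_neg (by omega), if_neg (by omega)]
      simp only [s]
      rw [Function.update_of_ne (by omega), Function.update_of_ne (by omega),
        Function.update_of_ne (by omega)]
      exact hm y (by omega)
    · rintro (h3 | h3)
      · exact hr h3
      · omega
  have hd := Runs.dup (x := x) (y := d) (z := d + 1) hx4.1 (by omega) (by omega) (by omega)
    (by omega) (by omega) hσ (hm d (by omega)) (hm (d + 1) (by omega))
  have hloop := Runs.whileNonempty (w := d) (τ := p (L + 1) + 3 * k + 3) n s (fun j _ => hsr j)
    (fun j hj => ?_) ?_ (fun j hj => (hround j hj).2)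
  · have e0 : s 0 = Instr.run (.push (d + 1) 0) (Function.update σ d (σ x)) := by
      funext y
      have := hm (d + 1) (by omega)
      simp only [s, Instr.run, Function.update_apply, ← hl]
      split_ifs <;> first | omega | simp_all
    have hxl : (σ x).length = l.length := rfl
    refine ⟨?_, ?_⟩
    · rw [hval, List.length_flatMap]
      have : ((List.range n).map fun j => (f j).length).sum ≤ n * p (L + 1) := by
        have := List.sum_le_card_nsmul ((List.range n).map fun j => (f j).length) (p (L + 1)) (by
          intro a ha
          simp only [List.mem_map, List.mem_range] at ha
          obtain ⟨j, hj, rfl⟩ := ha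
          exact (hround j hj).1)
        simpa using this
      have h4 : n * p (L + 1) ≤ L * (p (L + 1) + 3 * k + 5) := Nat.mul_le_mul hnL (by omega)
      omega
    · rw [hval]
      rw [e0] at hloop
      have hxL := hL x hx
      have hnn : n * (p (L + 1) + 3 * k + 3 + 2) ≤ L * (p (L + 1) + 3 * k + 5) :=
        Nat.mul_le_mul hnL (by omega)
      refine (hd.seq ((Runs.instr (.push (d + 1) 0) _).seq
        (hloop.seq (Runs.instr (.pop (d + 1)) _)))).cast ?_ (by omega)
      have h5 := hm (d + 1) (by omega)
      have h6 := hm d (by omega)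
      have h7 : l.drop (n * k) = [] := List.drop_of_length_le hnk
      funext y
      simp only [Instr.run, s, Function.update_apply, h7]
      split_ifs <;> first | omega | simp_all
  · simp only [s]
    rw [Function.update_of_ne (by omega), Function.update_of_ne (by omega), Function.update_self]
    simpa using hlt j hj
  · simp only [s]
    rw [Function.update_of_ne (by omega), Function.update_of_ne (by omega), Function.update_self]
    exact List.drop_of_length_le hnk

theorem compilesWithin_bind {d : ℕ} {e₁ e₂ : Expr} {A : ℕ → Prop} {m : ℕ}
    (he : (bind d e₁ e₂).Ok A m) (hA : ∀ x, A x → 4 ≤ x ∧ x < m) {p₁ p₂ : ℕ → ℕ}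
    (h₁ : e₁.CompilesWithin A (d + 1) p₁)
    (h₂ : e₂.CompilesWithin (fun y => A y ∨ y = d + 1) (d + 2) p₂) :
    (bind d e₁ e₂).CompilesWithin A m
      fun L => p₁ L + (p₁ L * 4 + 5) + p₂ (L + p₁ L) + (p₁ L * 3 + 5) := by
  obtain ⟨hmd, he₁, he₂⟩ := he
  intro L σ r hL hσ hm hr4 hrm hr
  beta_reduce
  have r₁ := h₁ L σ d hL hσ (fun i hi => hm i (by omega)) (by omega) (by omega)
    (fun h => by have := hA d h; omega)
  obtain ⟨hl₁, r₁⟩ := r₁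
  set v := e₁.eval σ with hv
  have hσd : σ d = [] := hm d (by omega)
  have hσd1 : σ (d + 1) = [] := hm (d + 1) (by omega)
  rw [hσd, List.append_nil] at r₁
  have rm := Runs.move (x := d) (y := d + 1) (by omega) (by omega) (by omega)
    (hσ.update (i := d) (by omega) v.reverse)
  have e1 : Function.update (Function.update (Function.update σ d v.reverse) d []) (d + 1)
      ((Function.update σ d v.reverse d).reverse ++ Function.update σ d v.reverse (d + 1)) =
      Function.update σ (d + 1) v := by
    funext y
    simp only [Function.update_apply]
    split_ifs <;> first | omega | simp_all
  rw [e1, Function.update_self, List.length_reverse] at rm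
  have hR := hσ.update (i := d + 1) (by omega) v
  obtain ⟨hl₂, r₂⟩ := h₂ (L + p₁ L) (Function.update σ (d + 1) v) r (fun x hx => by
      rw [Function.update_apply]
      split_ifs with h
      · omega
      · exact (hL x (hx.resolve_right h)).trans (by omega)) hR (fun i hi => by
      rw [Function.update_of_ne (by omega)]
      exact hm i (by omega)) hr4 (by omega) (by
      rintro (h | h)
      · exact hr h
      · omega)
  have rc := Runs.clear (x := d + 1) (by omega) (hR.update hr4
    ((e₂.eval (Function.update σ (d + 1) v)).reverse ++ Function.update σ (d + 1) v r))
  have hlen : (Function.update (Function.update σ (d + 1) v) r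
      ((e₂.eval (Function.update σ (d + 1) v)).reverse ++ Function.update σ (d + 1) v r)
      (d + 1)).length = v.length := by
    rw [Function.update_of_ne (by omega), Function.update_self]
  rw [hlen] at rc
  refine ⟨?_, ?_⟩
  · change (e₂.eval (Function.update σ (d + 1) v)).length ≤ _
    omega
  refine (r₁.seq (rm.seq (r₂.seq rc))).cast ?_ (by omega)
  funext y
  simp only [Function.update_apply, eval]
  split_ifs <;> first | omega | simp_all

theorem compilesWithin_iter {d x : ℕ} {e : Expr} {A : ℕ → Prop} {m : ℕ}
    (he : (iter d x e).Ok A m) (hA : ∀ x, A x → 4 ≤ x ∧ x < m) {p : ℕ → ℕ}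
    (h : e.CompilesWithin (fun y => A y ∨ y = d + 2) (d + 3) p) :
    (iter d x e).CompilesWithin A m fun L => L * (p L + L * 7 + 13) + L * 13 + 20 := by
  obtain ⟨hmd, hx, he, hlen⟩ := he
  intro L σ r hL hσ hm hr4 hrm hr
  beta_reduce
  have hx4 := hA x hx
  have hxL := hL x hx
  set l := σ x with hl
  set F : List ℕ → List ℕ := fun T => e.eval (Function.update σ (d + 2) T) with hF
  have hFlen : ∀ T, (F T).length ≤ l.length := fun T => by
    have := hlen (Function.update σ (d + 2) T)
    rwa [Function.update_of_ne (by omega)] at this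
  -- Without a uniform bound on the lengths, time bounds for the rounds could not be added up.
  have hTlen : ∀ j, (F^[j] []).length ≤ l.length := by
    intro j
    cases j with
    | zero => simp
    | succ j => rw [Function.iterate_succ_apply']; exact hFlen _
  let s : ℕ → Store := fun j =>
    Function.update (Function.update σ d (l.drop j)) (d + 2) (F^[j] [])
  have hsr : ∀ j, Ready (s j) := fun j => (hσ.update (by omega) _).update (by omega) _
  have hround : ∀ j < l.length,
      Runs (.instr (.pop d) ;; e.compile (d + 1) ;; clear (d + 2) ;; move (d + 1) (d + 2))
        (s j) (s (j + 1)) (p L + L * 7 + 11) := by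
    intro j hj
    set τ := Instr.run (.pop d) (s j) with hτ
    have hτR : Ready τ := (hsr j).update (by omega) _
    have hτ' : ∀ y, y ≠ d → τ y = Function.update σ (d + 2) (F^[j] []) y := by
      intro y hy
      simp only [hτ, Instr.run, s, Function.update_apply, if_neg hy]
    have hτd : τ d = l.drop (j + 1) := by
      simp only [hτ, Instr.run, s, Function.update_self]
      rw [Function.update_of_ne (by omega), Function.update_self, ← List.drop_one, List.drop_drop]
    have hτd1 : τ (d + 1) = [] := by
      rw [hτ' _ (by omega), Function.update_of_ne (by omega)]
      exact hm _ (by omega)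
    have hval : e.eval τ = F^[j + 1] [] := by
      rw [Function.iterate_succ_apply']
      refine eval_congr he fun y hy => hτ' y ?_
      rcases hy with hy | hy
      · have := hA y hy
        omega
      · omega
    obtain ⟨h1, h2⟩ := h L τ (d + 1) (fun y hy => by
        rw [hτ' y (by rcases hy with hy | hy; (· have := hA y hy; omega); (· omega)),
          Function.update_apply]
        split_ifs with h3
        · exact (hTlen j).trans hxL
        · exact hL y (hy.resolve_right h3)) hτR (fun i hi => by
        rw [hτ' i (by omega), Function.update_of_ne (by omega)]
        exact hm i (by omega)) (by omega) (by omega) (by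
        rintro (h3 | h3)
        · have := hA _ h3; omega
        · omega)
    rw [hval, hτd1, List.append_nil] at h2
    have hR1 := hτR.update (i := d + 1) (by omega) (F^[j + 1] []).reverse
    have h3 := Runs.clear (x := d + 2) (by omega) hR1
    have hR2 := hR1.update (i := d + 2) (by omega) []
    have h4 := Runs.move (x := d + 1) (y := d + 2) (by omega) (by omega) (by omega) hR2
    have l3 : (Function.update τ (d + 1) (F^[j + 1] []).reverse (d + 2)).length ≤ L := by
      rw [Function.update_of_ne (by omega), hτ' _ (by omega), Function.update_self]
      exact (hTlen j).trans hxL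
    have l4 : (Function.update (Function.update τ (d + 1) (F^[j + 1] []).reverse) (d + 2) []
        (d + 1)).length ≤ L := by
      rw [Function.update_of_ne (by omega), Function.update_self, List.length_reverse]
      exact (hTlen _).trans hxL
    refine ((Runs.instr (.pop d) _).seq (h2.seq (h3.seq h4))).cast ?_ (by omega)
    funext y
    simp only [s, Function.update_apply]
    by_cases h5 : y = d + 2
    · simp [h5]
    · by_cases h6 : y = d + 1
      · rw [if_neg h5, if_pos h6, if_neg h5, if_neg (by omega), h6]
        exact (hm _ (by omega)).symm
      · simp only [if_neg h5, if_neg h6]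
        split_ifs with h7
        · rw [h7, hτd]
        · rw [hτ' y h7, Function.update_of_ne h5]
  have hd := Runs.dup (x := x) (y := d) (z := d + 1) hx4.1 (by omega) (by omega) (by omega)
    (by omega) (by omega) hσ (hm d (by omega)) (hm (d + 1) (by omega))
  have hσd2 := hm (d + 2) (by omega)
  have hσd := hm d (by omega)
  have hloop := Runs.whileNonempty (w := d) l.length s (fun j _ => hsr j) (fun j hj => ?_) ?_
    hround
  · have e0 : s 0 = Function.update σ d (σ x) := by
      funext y
      simp only [s, Function.update_apply, ← hl]
      split_ifs <;> simp_all
    rw [e0] at hloop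
    have hmv := Runs.move (x := d + 2) (y := r) (by omega) (by omega) (by omega) (hsr l.length)
    have hval : (iter d x e).eval σ = F^[l.length] [] := rfl
    have hs2 : s l.length (d + 2) = F^[l.length] [] := by simp [s]
    rw [hs2] at hmv
    have hxl : (σ x).length = l.length := rfl
    have hT := (hTlen l.length).trans hxL
    have hnn : l.length * (p L + L * 7 + 11 + 2) ≤ L * (p L + L * 7 + 13) :=
      Nat.mul_le_mul hxL (by omega)
    refine ⟨by rw [hval]; omega, ?_⟩
    rw [hval]
    refine (hd.seq (hloop.seq hmv)).cast ?_ (by omega)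
    funext y
    simp only [s, Function.update_apply, List.drop_length]
    split_ifs <;> first | omega | simp_all
  · simp only [s]
    rw [Function.update_of_ne (by omega), Function.update_self]
    simpa using hj
  · simp [s]

/-- Expressions are evaluated in polynomial time. -/
theorem exists_compilesWithin {e : Expr} {A : ℕ → Prop} {m : ℕ} (he : e.Ok A m)
    (hA : ∀ x, A x → 4 ≤ x ∧ x < m) : ∃ p, Poly p ∧ e.CompilesWithin A m p := by
  induction e generalizing A m with
  | nil =>
    refine ⟨_, Poly.const 1, fun L σ r hL hσ hm hr4 hrm hr => ⟨by simp [eval], ?_⟩⟩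
    exact (Runs.skip hσ).cast (by simp [eval]) le_rfl
  | const c =>
    refine ⟨_, Poly.const 1, fun L σ r hL hσ hm hr4 hrm hr => ⟨by simp [eval], ?_⟩⟩
    exact (Runs.instr (.push r c) σ).cast (by simp [eval, Instr.run]) le_rfl
  | hd x =>
    refine ⟨_, Poly.const 1, fun L σ r hL hσ hm hr4 hrm hr => ⟨by simp [eval], ?_⟩⟩
    refine (Runs.instr (.copy x r) σ).cast ?_ le_rfl
    simp only [eval, Instr.run]
    congr
    rcases σ x with _ | ⟨a, l⟩ <;> simp
  | app e₁ e₂ ih₁ ih₂ =>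
    obtain ⟨p₁, hp₁, h₁⟩ := ih₁ he.1 hA
    obtain ⟨p₂, hp₂, h₂⟩ := ih₂ he.2 hA
    refine ⟨_, hp₁.add hp₂, fun L σ r hL hσ hm hr4 hrm hr => ?_⟩
    obtain ⟨l₁, r₁⟩ := h₁ L σ r hL hσ hm hr4 hrm hr
    set τ := Function.update σ r ((e₁.eval σ).reverse ++ σ r)
    have hτ : ∀ y, y ≠ r → τ y = σ y := fun y hy => Function.update_of_ne hy _ _
    have hev : e₂.eval τ = e₂.eval σ :=
      eval_congr he.2 fun y hy => hτ y fun h => hr (h ▸ hy)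
    obtain ⟨l₂, r₂⟩ := h₂ L τ r (fun y hy => by
      rw [hτ y fun h => hr (h ▸ hy)]; exact hL y hy) (hσ.update hr4 _)
      (fun i hi => by rw [hτ i (by omega)]; exact hm i hi) hr4 hrm hr
    rw [hev] at l₂ r₂
    refine ⟨by simp only [eval, List.length_append]; omega, (r₁.seq r₂).cast ?_ le_rfl⟩
    simp [τ, eval]
  | ite b e₁ e₂ ih₁ ih₂ =>
    obtain ⟨p₁, hp₁, h₁⟩ := ih₁ he.2.1 hA
    obtain ⟨p₂, hp₂, h₂⟩ := ih₂ he.2.2 hA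
    refine ⟨_, (hp₁.add hp₂).add (Poly.const 1), fun L σ r hL hσ hm hr4 hrm hr => ?_⟩
    obtain ⟨l₁, r₁⟩ := h₁ L σ r hL hσ hm hr4 hrm hr
    obtain ⟨l₂, r₂⟩ := h₂ L σ r hL hσ hm hr4 hrm hr
    unfold RunsWithin
    simp only [eval]
    split_ifs with hb
    · exact ⟨by omega, (Runs.ite_true hb r₁).mono (by omega)⟩
    · exact ⟨by omega, (Runs.ite_false hb r₂).mono (by omega)⟩
  | each d k x e ih =>
    obtain ⟨p, hp, h⟩ := ih he.2.2.2 (by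
      rintro y (hy | hy)
      · have := hA y hy
        have := he.1
        omega
      · have := hA x he.2.2.1
        have := he.1
        omega)
    exact ⟨_, ((Poly.id.mul (((hp.comp (Poly.id.add (Poly.const 1))).add
      (Poly.const (3 * k))).add (Poly.const 5))).add (Poly.id.mul (Poly.const 9))).add
        (Poly.const 20), compilesWithin_each he hA h⟩
  | bind d e₁ e₂ ih₁ ih₂ =>
    by_cases hm4 : 4 ≤ m
    · obtain ⟨p₁, hp₁, h₁⟩ := ih₁ he.2.1 (fun y hy => by
        have := hA y hy
        have := he.1
        omega)
      obtain ⟨p₂, hp₂, h₂⟩ := ih₂ he.2.2 (by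
        rintro y (hy | hy)
        · have := hA y hy
          have := he.1
          omega
        · have := he.1
          omega)
      exact ⟨_, (((hp₁.add ((hp₁.mul (Poly.const 4)).add (Poly.const 5))).add
        (hp₂.comp (Poly.id.add hp₁))).add ((hp₁.mul (Poly.const 3)).add (Poly.const 5))),
        compilesWithin_bind he hA h₁ h₂⟩
    · -- No stack below `m` can receive the value.
      exact ⟨_, Poly.const 0, fun L σ r hL hσ hm hr4 hrm hr => absurd hrm (by omega)⟩
  | iter d x e ih =>
    obtain ⟨p, hp, h⟩ := ih he.2.2.1 (by
      have := hA x he.2.1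
      rintro y (hy | hy)
      · have := hA y hy
        have := he.1
        omega
      · have := he.1
        omega)
    exact ⟨_, ((Poly.id.mul ((hp.add (Poly.id.mul (Poly.const 7))).add (Poly.const 13))).add
      (Poly.id.mul (Poly.const 13))).add (Poly.const 20), compilesWithin_iter he hA h⟩

end Expr

/-! ### Derivation forests -/

/-- `G.Yields l w`: there is a forest of derivation trees with the sequence of roots `l` and the
sequence of leaves `w`. -/
inductive CFG.Yields (G : CFG) : List (Symbol ℕ ℕ) → List ℕ → Prop
  | nil : Yields G [] []
  | terminal {a : ℕ} {l : List (Symbol ℕ ℕ)} {w : List ℕ} (h : Yields G l w) :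
      Yields G (.terminal a :: l) (a :: w)
  | nonterminal {p : ContextFreeRule ℕ ℕ} {l : List (Symbol ℕ ℕ)} {u v : List ℕ}
      (hp : p ∈ G.prods) (hu : Yields G p.output u) (hv : Yields G l v) :
      Yields G (.nonterminal p.input :: l) (u ++ v)

namespace CFG

variable {G : CFG}

theorem Yields.append {l m : List (Symbol ℕ ℕ)} {u v : List ℕ} (hu : G.Yields l u)
    (hv : G.Yields m v) : G.Yields (l ++ m) (u ++ v) := by
  induction hu with
  | nil => exact hv
  | terminal _ ih => exact .terminal ih
  | nonterminal hp hu _ _ ih =>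
    rw [List.append_assoc]
    exact .nonterminal hp hu ih

theorem yields_append {l m : List (Symbol ℕ ℕ)} {w : List ℕ} :
    G.Yields (l ++ m) w ↔ ∃ u v, w = u ++ v ∧ G.Yields l u ∧ G.Yields m v := by
  refine ⟨fun h => ?_, fun ⟨u, v, hw, hu, hv⟩ => hw ▸ hu.append hv⟩
  induction l generalizing w with
  | nil => exact ⟨[], w, rfl, .nil, h⟩
  | cons s l ih =>
    cases h with
    | terminal h =>
      obtain ⟨u, v, rfl, hu, hv⟩ := ih h
      exact ⟨_ :: u, v, rfl, .terminal hu, hv⟩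
    | nonterminal hp h1 h2 =>
      obtain ⟨u, v, rfl, hu, hv⟩ := ih h2
      exact ⟨_, v, (List.append_assoc _ _ _).symm, .nonterminal hp h1 hu, hv⟩

theorem yields_map_terminal (w : List ℕ) : G.Yields (w.map .terminal) w := by
  induction w with
  | nil => exact .nil
  | cons a w ih => exact .terminal ih

theorem yields_terminal {a : ℕ} {w : List ℕ} : G.Yields [.terminal a] w ↔ w = [a] := by
  refine ⟨fun h => ?_, fun h => h ▸ yields_map_terminal [a]⟩
  cases h with
  | terminal h => cases h; rfl

theorem yields_nonterminal {A : ℕ} {w : List ℕ} :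
    G.Yields [.nonterminal A] w ↔ ∃ p ∈ G.prods, p.input = A ∧ G.Yields p.output w := by
  refine ⟨fun h => ?_, ?_⟩
  · cases h with
    | nonterminal hp hu hv => cases hv; exact ⟨_, hp, rfl, by simpa using hu⟩
  · rintro ⟨p, hp, rfl, h⟩
    simpa using Yields.nonterminal hp h .nil

theorem derives_iff_yields {l : List (Symbol ℕ ℕ)} {w : List ℕ} :
    G.toCFG.Derives l (w.map .terminal) ↔ G.Yields l w := by
  refine ⟨fun h => ?_, fun h => ?_⟩
  · induction h using Relation.ReflTransGen.head_induction_on with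
    | refl => exact yields_map_terminal w
    | head h _ ih =>
      obtain ⟨p, hp, h⟩ := h
      obtain ⟨x, y, rfl, rfl⟩ := h.exists_parts
      have hp' : p ∈ G.prods := by simpa using hp
      obtain ⟨u, v, rfl, h1, h2⟩ := yields_append.1 ih
      obtain ⟨u, v', rfl, h1, h3⟩ := yields_append.1 h1
      exact (h1.append (yields_nonterminal.2 ⟨p, hp', rfl, h3⟩)).append h2
  · induction h with
    | nil => exact .refl _
    | @terminal a l w _ ih => exact ih.append_left [.terminal a]
    | @nonterminal p l u v hp _ _ ih₁ ih₂ =>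
      have h1 : G.toCFG.Produces [.nonterminal p.input] p.output :=
        ⟨p, by simpa using hp, ContextFreeRule.Rewrites.input_output⟩
      have h2 := (h1.single.trans ih₁).append_right l
      have h3 := ih₂.append_left (u.map .terminal)
      rw [List.map_append]
      exact h2.trans h3

theorem mem_language {w : List ℕ} : w ∈ G.language ↔ G.Yields [.nonterminal G.start] w :=
  derives_iff_yields

/-! ### Simple grammars are LL(1) and deterministic -/

theorem IsSimple.isLL1 (hG : G.IsSimple) : G.IsLL1 := by
  intro w α p hp q hq hpq _ x y hx hy hxy
  rw [derives_iff_yields] at hx hy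
  obtain ⟨a, As, ha⟩ := hG.1 p hp
  obtain ⟨b, Bs, hb⟩ := hG.1 q hq
  rw [ha] at hx
  rw [hb] at hy
  cases hx
  cases hy
  simp only [List.head?_cons, Option.some.injEq] at hxy
  subst hxy
  rw [hG.2 p hp q hq a hpq (by simp [ha]) (by simp [hb])]

/-- A number that bounds all nonterminals of the grammar. It makes the stack alphabet of the
automaton finite. -/
def maxNonterminal (G : CFG) : ℕ :=
  G.start + (G.prods.flatMap fun p => p.input :: p.output.map fun
    | .terminal _ => 0
    | .nonterminal A => A).sum

/-- The terminals that occur in the productions. -/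
def terminals (G : CFG) : Finset ℕ :=
  (G.prods.flatMap fun p => p.output.map fun
    | .terminal a => a
    | .nonterminal _ => 0).toFinset

theorem le_maxNonterminal_of_mem {p : ContextFreeRule ℕ ℕ} (hp : p ∈ G.prods) {A : ℕ}
    (hA : Symbol.nonterminal A ∈ p.output) : A ≤ G.maxNonterminal := by
  refine le_add_of_le_right (List.single_le_sum (by simp) _ ?_)
  exact List.mem_flatMap.2 ⟨p, hp, List.mem_cons_of_mem _ (List.mem_map.2 ⟨_, hA, rfl⟩)⟩

open Classical in
/-- The moves of the automaton that recognizes a simple grammar. In state `0` it puts the start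
symbol above the bottom `none` of the stack, in state `1` it replaces the nonterminal on top
according to the next letter, and it accepts in state `2`, when the bottom is reached. -/
noncomputable def dpdaMove (G : CFG) : Fin 3 → Option ℕ → Option (Fin (G.maxNonterminal + 1)) →
    Option (Fin 3 × List (Option (Fin (G.maxNonterminal + 1))))
  | 0, none, none => some (1, [some (Fin.ofNat _ G.start), none])
  | 1, none, none => some (2, [])
  | 1, some a, some Z =>
    if h : ∃ As : List ℕ, ⟨Z, .terminal a :: As.map .nonterminal⟩ ∈ G.prods then
      some (1, h.choose.map fun A => some (Fin.ofNat _ A))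
    else none
  | _, _, _ => none

/-- The automaton that recognizes a simple grammar. -/
noncomputable def dpda (G : CFG) : DPDA where
  Q := Fin 3
  Γ := Option (Fin (G.maxNonterminal + 1))
  finite_Q := inferInstance
  finite_Γ := inferInstance
  alphabet := G.terminals
  start := 0
  bottom := none
  accept := {2}
  δ := G.dpdaMove
  δ_alphabet q a Z ha := by
    fin_cases q <;> rcases Z with _ | Z <;> simp only [dpdaMove]
    refine dif_neg ?_
    rintro ⟨As, h⟩
    refine ha ?_
    simp only [terminals, List.mem_toFinset, List.mem_flatMap]
    exact ⟨_, h, List.mem_map.2 ⟨.terminal a, by simp, rfl⟩⟩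
  deterministic q Z h a := by
    fin_cases q <;> rcases Z with _ | Z <;> simp [dpdaMove] at h ⊢

/-- The stack that holds the nonterminals `As`. -/
def stackOf (G : CFG) (As : List ℕ) : List (Option (Fin (G.maxNonterminal + 1))) :=
  As.map fun A => some (Fin.ofNat _ A)

/-- A configuration of the automaton. -/
def conf (G : CFG) (q : Fin 3) (w : List ℕ) (γ : List (Option (Fin (G.maxNonterminal + 1)))) :
    G.dpda.Q × List ℕ × List G.dpda.Γ := (q, w, γ)

theorem step_read {q q' : Fin 3} {a : ℕ} {w : List ℕ} {Z : Option (Fin (G.maxNonterminal + 1))}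
    {ζ γ : List (Option (Fin (G.maxNonterminal + 1)))}
    (h : G.dpdaMove q (some a) Z = some (q', ζ)) :
    G.dpda.Step (G.conf q (a :: w) (Z :: γ)) (G.conf q' w (ζ ++ γ)) :=
  DPDA.Step.read (M := G.dpda) h

theorem step_silent {q q' : Fin 3} {w : List ℕ} {Z : Option (Fin (G.maxNonterminal + 1))}
    {ζ γ : List (Option (Fin (G.maxNonterminal + 1)))}
    (h : G.dpdaMove q none Z = some (q', ζ)) :
    G.dpda.Step (G.conf q w (Z :: γ)) (G.conf q' w (ζ ++ γ)) :=
  DPDA.Step.silent (M := G.dpda) h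

theorem eq_of_step {q : Fin 3} {w : List ℕ} {γ : List (Option (Fin (G.maxNonterminal + 1)))}
    {c : G.dpda.Q × List ℕ × List G.dpda.Γ} (h : G.dpda.Step (G.conf q w γ) c) :
    ∃ Z δ q' ζ, γ = Z :: δ ∧
      ((∃ a v, w = a :: v ∧ G.dpdaMove q (some a) Z = some (q', ζ) ∧ c = G.conf q' v (ζ ++ δ)) ∨
        (G.dpdaMove q none Z = some (q', ζ) ∧ c = G.conf q' w (ζ ++ δ))) := by
  generalize hc : G.conf q w γ = c' at h
  cases h with
  | read h =>
    simp only [conf] at hc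
    obtain ⟨rfl, rfl, rfl⟩ := hc
    exact ⟨_, _, _, _, rfl, Or.inl ⟨_, _, rfl, h, rfl⟩⟩
  | silent h =>
    simp only [conf] at hc
    obtain ⟨rfl, rfl, rfl⟩ := hc
    exact ⟨_, _, _, _, rfl, Or.inr ⟨h, rfl⟩⟩

theorem conf_inj {q q' : Fin 3} {w w' : List ℕ}
    {γ γ' : List (Option (Fin (G.maxNonterminal + 1)))} (h : G.conf q w γ = G.conf q' w' γ') :
    q = q' ∧ w = w' ∧ γ = γ' := by
  exact ⟨congrArg (fun c => c.1) h, congrArg (fun c => c.2.1) h, congrArg (fun c => c.2.2) h⟩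

theorem IsSimple.dpdaMove_eq (hG : G.IsSimple) {A a : ℕ} {As : List ℕ}
    (h : ⟨A, .terminal a :: As.map .nonterminal⟩ ∈ G.prods) (hA : A ≤ G.maxNonterminal) :
    G.dpdaMove 1 (some a) (some (Fin.ofNat _ A)) = some (1, G.stackOf As) := by
  have hval : ((Fin.ofNat (G.maxNonterminal + 1) A : Fin _) : ℕ) = A :=
    Nat.mod_eq_of_lt (by omega)
  have hex : ∃ As : List ℕ, ⟨((Fin.ofNat (G.maxNonterminal + 1) A : Fin _) : ℕ),
      .terminal a :: As.map .nonterminal⟩ ∈ G.prods := ⟨As, by rwa [hval]⟩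
  have hc := hex.choose_spec
  have := hG.2 _ hc _ h a hval rfl rfl
  simp only [ContextFreeRule.mk.injEq, List.cons.injEq, true_and] at this
  have hAs : hex.choose = As :=
    List.map_injective_iff.2 (fun x y h => by injection h) this.2
  rw [dpdaMove, dif_pos hex, hAs]
  rfl

theorem IsSimple.reaches_of_yields (hG : G.IsSimple) {l : List (Symbol ℕ ℕ)} {w : List ℕ}
    (h : G.Yields l w) :
    (∀ As : List ℕ, l = As.map .nonterminal → (∀ A ∈ As, A ≤ G.maxNonterminal) → ∀ x γ,
      Relation.ReflTransGen G.dpda.Step (G.conf 1 (w ++ x) (G.stackOf As ++ γ))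
        (G.conf 1 x γ)) ∧
    (∀ (a : ℕ) (As : List ℕ), l = .terminal a :: As.map .nonterminal →
      (∀ A ∈ As, A ≤ G.maxNonterminal) → ∃ v, w = a :: v ∧ ∀ x γ,
      Relation.ReflTransGen G.dpda.Step (G.conf 1 (v ++ x) (G.stackOf As ++ γ))
        (G.conf 1 x γ)) := by
  induction h with
  | nil =>
    refine ⟨?_, by simp⟩
    rintro (_ | ⟨A, As⟩) h _ x γ
    · exact .refl
    · simp at h
  | @terminal a l w h ih =>
    refine ⟨?_, ?_⟩
    · rintro (_ | ⟨A, As⟩) h <;> simp at h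
    · intro b As h hle
      simp only [List.cons.injEq, Symbol.terminal.injEq] at h
      exact ⟨w, by rw [h.1], ih.1 As h.2 hle⟩
  | @nonterminal p l u v hp hu hv ih₁ ih₂ =>
    refine ⟨?_, by simp⟩
    rintro (_ | ⟨A, As⟩) h hle x γ
    · simp at h
    · simp only [List.map_cons, List.cons.injEq, Symbol.nonterminal.injEq] at h
      obtain ⟨a, Bs, ha⟩ := hG.1 p hp
      obtain ⟨u', rfl, hrun⟩ := ih₁.2 a Bs ha fun B hB =>
        le_maxNonterminal_of_mem hp (by simp [ha, hB])
      have hmem : ⟨A, .terminal a :: Bs.map .nonterminal⟩ ∈ G.prods := by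
        rw [← ha, ← h.1]; exact hp
      have hmove := hG.dpdaMove_eq hmem (hle A (by simp))
      have hstep : G.dpda.Step (G.conf 1 (a :: (u' ++ v ++ x)) (G.stackOf (A :: As) ++ γ))
          (G.conf 1 (u' ++ v ++ x) (G.stackOf Bs ++ (G.stackOf As ++ γ))) :=
        step_read hmove
      refine (Relation.ReflTransGen.single hstep).trans ?_
      rw [List.append_assoc]
      exact (hrun _ _).trans (ih₂.1 As h.2 (fun A hA => hle A (by simp [hA])) x γ)

theorem yields_of_reaches {c : G.dpda.Q × List ℕ × List G.dpda.Γ}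
    {γ : List (Option (Fin (G.maxNonterminal + 1)))}
    (h : Relation.ReflTransGen G.dpda.Step c (G.conf 2 [] γ)) :
    (∀ w, c = G.conf 2 w [] → w = []) ∧
    ∀ w As, c = G.conf 1 w (G.stackOf As ++ [none]) → (∀ A ∈ As, A ≤ G.maxNonterminal) →
      G.Yields (As.map .nonterminal) w := by
  induction h using Relation.ReflTransGen.head_induction_on with
  | refl =>
    exact ⟨fun w h => (conf_inj h).2.1.symm, fun w As h => absurd (conf_inj h).1 (by decide)⟩
  | head hstep _ ih =>
    refine ⟨?_, ?_⟩
    · rintro w rfl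
      obtain ⟨Z, δ, q', ζ, h, -⟩ := eq_of_step hstep
      cases h
    · rintro w (_ | ⟨A, As⟩) rfl hle
      · obtain ⟨Z, δ, q', ζ, h, ⟨a, v, rfl, hm, rfl⟩ | ⟨hm, rfl⟩⟩ := eq_of_step hstep
        · cases h
          cases hm
        · cases h
          cases hm
          obtain rfl := ih.1 _ rfl
          exact .nil
      · obtain ⟨Z, δ, q', ζ, h, ⟨a, v, rfl, hm, rfl⟩ | ⟨hm, rfl⟩⟩ := eq_of_step hstep
        · simp only [stackOf, List.map_cons, List.cons_append, List.cons.injEq] at h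
          obtain ⟨rfl, rfl⟩ := h
          rw [dpdaMove] at hm
          split_ifs at hm with hex
          simp only [Option.some.injEq, Prod.mk.injEq] at hm
          obtain ⟨rfl, rfl⟩ := hm
          have hmem := hex.choose_spec
          set Bs := hex.choose
          have hval : ((Fin.ofNat (G.maxNonterminal + 1) A : Fin _) : ℕ) = A :=
            Nat.mod_eq_of_lt (by have := hle A (by simp); omega)
          rw [hval] at hmem
          have h1 := ih.2 v (Bs ++ As) (by simp [stackOf]) (by
            intro B hB
            rcases List.mem_append.1 hB with hB | hB
            · exact le_maxNonterminal_of_mem hmem (by simp [hB])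
            · exact hle B (by simp [hB]))
          rw [List.map_append] at h1
          obtain ⟨u, v, rfl, hu, hv⟩ := yields_append.1 h1
          exact Yields.nonterminal hmem (.terminal hu) hv
        · cases h
          cases hm

theorem IsSimple.isDeterministic (hG : G.IsSimple) : G.IsDeterministic := by
  refine ⟨G.dpda, Set.ext fun w => ?_⟩
  have hstart : G.start ≤ G.maxNonterminal := Nat.le_add_right _ _
  have h0 : G.dpda.Step (G.conf 0 w [none]) (G.conf 1 w (G.stackOf [G.start] ++ [none])) :=
    step_silent (G := G) (ζ := G.stackOf [G.start] ++ [none]) (γ := []) rfl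
  have h2 : G.dpda.Step (G.conf 1 [] [none]) (G.conf 2 [] []) :=
    step_silent (G := G) (ζ := []) (γ := []) rfl
  change _ ↔ w ∈ G.language
  rw [mem_language]
  constructor
  · rintro ⟨q, γ, hq, h⟩
    obtain rfl : q = (2 : Fin 3) := hq
    change Relation.ReflTransGen G.dpda.Step (G.conf 0 w [none]) (G.conf 2 [] γ) at h
    rcases Relation.ReflTransGen.cases_head h with h | ⟨c, hc, h⟩
    · exact absurd (conf_inj h).1 (by decide)
    · obtain ⟨Z, δ, q', ζ, h', ⟨a, v, rfl, hm, rfl⟩ | ⟨hm, rfl⟩⟩ := eq_of_step hc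
      · cases h'
        cases hm
      · cases h'
        cases hm
        exact (yields_of_reaches h).2 w [G.start] rfl (by simpa using hstart)
  · intro h
    have h1 := (hG.reaches_of_yields h).1 [G.start] rfl (by simpa using hstart) [] [none]
    rw [List.append_nil] at h1
    exact ⟨(2 : Fin 3), [], rfl, ((Relation.ReflTransGen.single h0).trans h1).tail h2⟩

end CFG

/-! ### Grammars with right-hand sides of length one and two -/

/-- The nodes of the binary form of a grammar: `(0, a)` is the terminal `a`, `(1, A)` is the
nonterminal `A`, and `(2, i)` is a proper suffix of a right-hand side. The nodes `(3, 0)` and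
`(3, 1)` serve to start a derivation. -/
abbrev Node := ℕ × ℕ

/-- The node of a symbol. -/
def symbolNode : Symbol ℕ ℕ → Node
  | .terminal a => (0, a)
  | .nonterminal A => (1, A)

theorem symbolNode_injective : Function.Injective symbolNode := by
  rintro (a | A) (b | B) h <;> simp_all [symbolNode]

/-- The binary form of a grammar: productions `C → X` in `unit`, productions `C → X Y` in `binary`.
The number `next` is the index of the next new suffix. -/
structure Tables where
  next : ℕ
  unit : List (Node × Node)
  binary : List (Node × Node × Node)

/-- Add productions by which the node `K` derives the right-hand side. -/
def scanOutput : Node → List (Symbol ℕ ℕ) → Tables → Tables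
  | _, [], t => t
  | K, [x], t => ⟨t.next, (K, symbolNode x) :: t.unit, t.binary⟩
  | K, x :: y :: l, t => scanOutput (2, t.next) (y :: l)
      ⟨t.next + 1, t.unit, (K, symbolNode x, (2, t.next)) :: t.binary⟩

/-- Add the binary forms of the productions. -/
def scanProds : List (ContextFreeRule ℕ ℕ) → Tables → Tables
  | [], t => t
  | p :: ps, t => scanProds ps (scanOutput (1, p.input) p.output t)

/-- The production `(3, 1) → (3, 0) S`. The node `(3, 0)` derives nothing: it is the left corner
that is completed to `(3, 1)` by the words that `S` derives. -/
def startTriple (H : CFG) : Node × Node × Node := ((3, 1), (3, 0), (1, H.start))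

/-- The binary form of a grammar. -/
def CFG.tables (H : CFG) : Tables := scanProds H.prods ⟨0, [], [startTriple H]⟩

/-- `t.Gen K w`: the node `K` derives the word `w`. -/
inductive Tables.Gen (t : Tables) : Node → List ℕ → Prop
  | leaf (a : ℕ) : Gen t (0, a) [a]
  | unit {C X : Node} {w : List ℕ} (h : (C, X) ∈ t.unit) (hw : Gen t X w) : Gen t C w
  | binary {C X Y : Node} {u v : List ℕ} (h : (C, X, Y) ∈ t.binary) (hu : Gen t X u)
      (hv : Gen t Y v) : Gen t C (u ++ v)

/-- Every symbol of `l` derives its piece of `w`. -/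
def Tables.GenList (t : Tables) : List (Symbol ℕ ℕ) → List ℕ → Prop
  | [], w => w = []
  | x :: l, w => ∃ u v, w = u ++ v ∧ t.Gen (symbolNode x) u ∧ t.GenList l v

/-- The tables of `t` are contained in those of `t'`. -/
def Tables.Sub (t t' : Tables) : Prop := t.unit ⊆ t'.unit ∧ t.binary ⊆ t'.binary

theorem sub_scanOutput (K : Node) (l : List (Symbol ℕ ℕ)) (t : Tables) :
    t.Sub (scanOutput K l t) := by
  induction l generalizing K t with
  | nil => exact ⟨List.Subset.refl _, List.Subset.refl _⟩
  | cons x l ih =>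
    cases l with
    | nil => exact ⟨List.subset_cons_self _ _, List.Subset.refl _⟩
    | cons y l =>
      have := ih (2, t.next) ⟨t.next + 1, t.unit, (K, symbolNode x, (2, t.next)) :: t.binary⟩
      exact ⟨this.1, List.Subset.trans (List.subset_cons_self _ _) this.2⟩

theorem sub_scanProds (ps : List (ContextFreeRule ℕ ℕ)) (t : Tables) :
    t.Sub (scanProds ps t) := by
  induction ps generalizing t with
  | nil => exact ⟨List.Subset.refl _, List.Subset.refl _⟩
  | cons p ps ih =>
    have h1 := sub_scanOutput (1, p.input) p.output t
    have h2 := ih (scanOutput (1, p.input) p.output t)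
    exact ⟨List.Subset.trans h1.1 h2.1, List.Subset.trans h1.2 h2.2⟩

theorem gen_of_scanOutput {K : Node} {l : List (Symbol ℕ ℕ)} {t t' : Tables} (hl : l ≠ [])
    (h : (scanOutput K l t).Sub t') {w : List ℕ} (hw : t'.GenList l w) : t'.Gen K w := by
  induction l generalizing K t w with
  | nil => exact absurd rfl hl
  | cons x l ih =>
    obtain ⟨u, v, rfl, hu, hv⟩ := hw
    cases l with
    | nil =>
      rw [show v = [] from hv, List.append_nil]
      exact .unit (h.1 (by simp [scanOutput])) hu
    | cons y l =>
      refine .binary (h.2 ?_) hu (ih (by simp) h hv)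
      exact (sub_scanOutput (2, t.next) (y :: l) _).2 List.mem_cons_self

theorem sub_tables_of_mem {ps : List (ContextFreeRule ℕ ℕ)} {p : ContextFreeRule ℕ ℕ}
    (hp : p ∈ ps) (t : Tables) :
    ∃ t₀, (scanOutput (1, p.input) p.output t₀).Sub (scanProds ps t) := by
  induction ps generalizing t with
  | nil => simp at hp
  | cons q ps ih =>
    rcases List.mem_cons.1 hp with rfl | hp
    · exact ⟨t, sub_scanProds ps _⟩
    · exact ih hp _

theorem gen_of_yields {H : CFG} {l : List (Symbol ℕ ℕ)} {w : List ℕ} (h : H.Yields l w) :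
    H.tables.GenList l w := by
  induction h with
  | nil => rfl
  | @terminal a l w _ ih => exact ⟨[a], w, rfl, .leaf a, ih⟩
  | @nonterminal p l u v hp _ _ ih₁ ih₂ =>
    refine ⟨u, v, rfl, ?_, ih₂⟩
    obtain ⟨t₀, h⟩ := sub_tables_of_mem hp ⟨0, [], [startTriple H]⟩
    exact gen_of_scanOutput (H.output_ne_nil p hp) h ih₁

/-- The node `K` has the right-hand side `l`, where `sufs` lists the suffixes that have nodes. -/
def Expands (H : CFG) (sufs : List (List (Symbol ℕ ℕ))) (K : Node) (l : List (Symbol ℕ ℕ)) : Prop :=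
  (∃ p ∈ H.prods, K = (1, p.input) ∧ l = p.output) ∨ (K.1 = 2 ∧ sufs[K.2]? = some l)

/-- All productions in the tables agree with the grammar. -/
structure Tables.Sound (t : Tables) (H : CFG) (sufs : List (List (Symbol ℕ ℕ))) : Prop where
  next_eq : t.next = sufs.length
  unit_mem : ∀ e ∈ t.unit, ∃ x, e.2 = symbolNode x ∧ Expands H sufs e.1 [x]
  binary_mem : ∀ e ∈ t.binary, e = startTriple H ∨ ∃ x l, e.2.1 = symbolNode x ∧
    Expands H sufs e.1 (x :: l) ∧ e.2.2.1 = 2 ∧ sufs[e.2.2.2]? = some l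

theorem Expands.append {H : CFG} {sufs : List (List (Symbol ℕ ℕ))} {K : Node}
    {l m : List (Symbol ℕ ℕ)} (h : Expands H sufs K l) : Expands H (sufs ++ [m]) K l := by
  rcases h with h | ⟨h1, h2⟩
  · exact .inl h
  · refine .inr ⟨h1, ?_⟩
    rw [List.getElem?_append_left, h2]
    exact (List.getElem?_eq_some_iff.1 h2).1

theorem Tables.Sound.scanOutput {t : Tables} {H : CFG} {sufs : List (List (Symbol ℕ ℕ))}
    (ht : t.Sound H sufs) {K : Node} {l : List (Symbol ℕ ℕ)} (hK : Expands H sufs K l) :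
    ∃ sufs', (scanOutput K l t).Sound H sufs' := by
  induction l generalizing t sufs K with
  | nil => exact ⟨sufs, ht⟩
  | cons x l ih =>
    cases l with
    | nil =>
      refine ⟨sufs, ht.next_eq, ?_, ht.binary_mem⟩
      intro e he
      rcases List.mem_cons.1 he with rfl | he
      · exact ⟨x, rfl, hK⟩
      · exact ht.unit_mem e he
    | cons y l =>
      have hget : (sufs ++ [y :: l])[t.next]? = some (y :: l) := by
        rw [ht.next_eq, List.getElem?_concat_length]
      refine ih (sufs := sufs ++ [y :: l]) ⟨?_, ?_, ?_⟩ (.inr ⟨rfl, hget⟩)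
      · simp [ht.next_eq]
      · intro e he
        obtain ⟨x, hx, h⟩ := ht.unit_mem e he
        exact ⟨x, hx, h.append⟩
      · intro e he
        rcases List.mem_cons.1 he with rfl | he
        · exact .inr ⟨x, y :: l, rfl, hK.append, rfl, hget⟩
        · rcases ht.binary_mem e he with h | ⟨x, l, hx, h1, h2, h3⟩
          · exact .inl h
          · refine .inr ⟨x, l, hx, h1.append, h2, ?_⟩
            rw [List.getElem?_append_left, h3]
            exact (List.getElem?_eq_some_iff.1 h3).1

theorem Tables.Sound.scanProds {t : Tables} {H : CFG} {sufs : List (List (Symbol ℕ ℕ))}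
    (ht : t.Sound H sufs) {ps : List (ContextFreeRule ℕ ℕ)} (hps : ps ⊆ H.prods) :
    ∃ sufs', (scanProds ps t).Sound H sufs' := by
  induction ps generalizing t sufs with
  | nil => exact ⟨sufs, ht⟩
  | cons p ps ih =>
    obtain ⟨sufs', h⟩ := ht.scanOutput (K := (1, p.input)) (l := p.output)
      (.inl ⟨p, hps List.mem_cons_self, rfl, rfl⟩)
    exact ih h fun q hq => hps (List.mem_cons_of_mem _ hq)

theorem CFG.exists_sound_tables (H : CFG) : ∃ sufs, H.tables.Sound H sufs :=
  Tables.Sound.scanProds (sufs := []) ⟨rfl, by simp, by simp⟩ (List.Subset.refl _)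

theorem Tables.Sound.yields {t : Tables} {H : CFG} {sufs : List (List (Symbol ℕ ℕ))}
    (ht : t.Sound H sufs) {K : Node} {w : List ℕ} (h : t.Gen K w) :
    (∀ x, K = symbolNode x → H.Yields [x] w) ∧
      (K.1 = 2 → ∀ l, sufs[K.2]? = some l → H.Yields l w) := by
  -- A node determines its symbol or its suffix.
  have key : ∀ {K l w}, Expands H sufs K l → H.Yields l w →
      (∀ x, K = symbolNode x → H.Yields [x] w) ∧
        (K.1 = 2 → ∀ l, sufs[K.2]? = some l → H.Yields l w) := by
    rintro K l w (⟨p, hp, rfl, rfl⟩ | ⟨h1, h2⟩) hw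
    · refine ⟨?_, fun h => absurd h (by simp)⟩
      intro x hx
      obtain rfl := symbolNode_injective (a₁ := .nonterminal p.input) hx
      exact CFG.yields_nonterminal.2 ⟨p, hp, rfl, hw⟩
    · refine ⟨?_, fun _ l' h => ?_⟩
      · rintro (a | A) rfl <;> simp [symbolNode] at h1
      · rw [h2] at h
        injection h with h
        exact h ▸ hw
  induction h with
  | leaf a =>
    refine ⟨?_, fun h => absurd h (by simp)⟩
    intro x hx
    obtain rfl := symbolNode_injective (a₁ := .terminal a) hx
    exact CFG.yields_terminal.2 rfl
  | unit h _ ih =>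
    obtain ⟨x, hx, hK⟩ := ht.unit_mem _ h
    exact key hK (ih.1 x hx)
  | @binary C X Y u v h _ _ ihu ihv =>
    rcases ht.binary_mem _ h with h | ⟨x, l, hx, hK, h2, h3⟩
    · cases h
      exact ⟨by rintro (a | A) h <;> simp [symbolNode] at h, fun h => absurd h (by simp)⟩
    · exact key hK ((ihu.1 x hx).append (ihv.2 h2 l h3))

/-- The binary form generates the language of the grammar. -/
theorem CFG.gen_tables_iff (H : CFG) {w : List ℕ} :
    H.tables.Gen (1, H.start) w ↔ w ∈ H.language := by
  rw [CFG.mem_language]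
  constructor
  · intro h
    obtain ⟨sufs, hs⟩ := H.exists_sound_tables
    exact (hs.yields h).1 (.nonterminal H.start) rfl
  · intro h
    obtain ⟨u, v, rfl, hu, rfl⟩ := gen_of_yields h
    rw [List.append_nil]
    exact hu

/-! ### Left corners -/

namespace Tables

/-- There is a chain of unit productions from `A` to `X`. -/
def Chain (t : Tables) : Node → Node → Prop := Relation.ReflTransGen fun A X => (A, X) ∈ t.unit

/-- `t.Corner A X w`: there is a derivation tree with root `A` whose leftmost branch ends in a leaf
`X`, and `w` is the word derived by the rest of the tree. Along the branch, from `X` up to `A`,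
chains of unit productions alternate with binary productions. -/
inductive Corner (t : Tables) : Node → Node → List ℕ → Prop
  | nil {A X : Node} (h : t.Chain A X) : Corner t A X []
  | cons {A C X X' Y : Node} {u v : List ℕ} (hB : (C, X', Y) ∈ t.binary) (hX : t.Chain X' X)
      (hu : t.Gen Y u) (hv : Corner t A C v) : Corner t A X (u ++ v)

/-- All nodes that occur in the tables. -/
def nodes (t : Tables) : List Node :=
  (3, 1) :: (3, 0) :: (t.binary.flatMap (fun e => [e.1, e.2.1, e.2.2]) ++
    t.unit.flatMap (fun e => [e.1, e.2]))

theorem mem_nodes_of_binary {t : Tables} {C X Y : Node} (h : (C, X, Y) ∈ t.binary) :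
    C ∈ t.nodes ∧ X ∈ t.nodes ∧ Y ∈ t.nodes := by
  have : ∀ Z, Z ∈ [C, X, Y] → Z ∈ t.nodes := fun Z hZ =>
    List.mem_cons_of_mem _ (List.mem_cons_of_mem _ (List.mem_append_left _
      (List.mem_flatMap.2 ⟨_, h, hZ⟩)))
  exact ⟨this C (by simp), this X (by simp), this Y (by simp)⟩

theorem mem_nodes_of_unit {t : Tables} {C X : Node} (h : (C, X) ∈ t.unit) :
    C ∈ t.nodes ∧ X ∈ t.nodes := by
  have : ∀ Z, Z ∈ [C, X] → Z ∈ t.nodes := fun Z hZ =>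
    List.mem_cons_of_mem _ (List.mem_cons_of_mem _ (List.mem_append_right _
      (List.mem_flatMap.2 ⟨_, h, hZ⟩)))
  exact ⟨this C (by simp), this X (by simp)⟩

theorem Gen.chain {t : Tables} {A X : Node} {w : List ℕ} (h : t.Chain A X) (hw : t.Gen X w) :
    t.Gen A w := by
  induction h using Relation.ReflTransGen.head_induction_on with
  | refl => exact hw
  | head h _ ih => exact .unit h ih

theorem Corner.chain {t : Tables} {A A' X : Node} {w : List ℕ} (h : t.Chain A' A)
    (hw : t.Corner A X w) : t.Corner A' X w := by
  induction hw with
  | nil h' => exact .nil (h.trans h')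
  | cons hB hX hu _ ih => exact .cons hB hX hu ih

theorem Corner.append {t : Tables} {C X Y Z : Node} {u v : List ℕ} (hu : t.Corner X Z u)
    (hB : (C, X, Y) ∈ t.binary) (hv : t.Gen Y v) : t.Corner C Z (u ++ v) := by
  induction hu with
  | nil h => simpa using Corner.cons hB h hv (.nil .refl)
  | cons hB' hX hu _ ih =>
    rw [List.append_assoc]
    exact .cons hB' hX hu ih

/-- A derivation tree splits into its leftmost leaf and the rest. -/
theorem Gen.exists_corner {t : Tables} {A : Node} {w : List ℕ} (h : t.Gen A w)
    (hA : A ∈ t.nodes) : ∃ a v, w = a :: v ∧ (0, a) ∈ t.nodes ∧ t.Corner A (0, a) v := by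
  induction h with
  | leaf a => exact ⟨a, [], rfl, hA, .nil .refl⟩
  | unit h _ ih =>
    obtain ⟨a, v, rfl, ha, hv⟩ := ih (mem_nodes_of_unit h).2
    exact ⟨a, v, rfl, ha, hv.chain (.single h)⟩
  | @binary C X Y u w h hu hv ihu _ =>
    obtain ⟨a, v, rfl, ha, hv'⟩ := ihu (mem_nodes_of_binary h).2.1
    exact ⟨a, v ++ w, rfl, ha, hv'.append h hv⟩

theorem Corner.gen {t : Tables} {A X : Node} {u v : List ℕ} (hv : t.Corner A X v)
    (hu : t.Gen X u) : t.Gen A (u ++ v) := by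
  induction hv generalizing u with
  | nil h => simpa using hu.chain h
  | cons hB hX hu' _ ih =>
    rw [← List.append_assoc]
    exact ih (.binary hB (hu.chain hX) hu')

/-! ### The chains of unit productions -/

/-- All pairs of nodes. The nonterminals of the normal form are the indices of this list. -/
def pairs (t : Tables) : List (Node × Node) :=
  t.nodes.flatMap fun A => t.nodes.flatMap fun X => [(A, X)]

theorem mem_pairs {t : Tables} {p : Node × Node} :
    p ∈ t.pairs ↔ p.1 ∈ t.nodes ∧ p.2 ∈ t.nodes := by
  obtain ⟨A, X⟩ := p
  simp [pairs]

/-- The pairs that are equal or arise from a pair in `T` by one more unit production. -/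
def chainStep (t : Tables) (T : List (Node × Node)) : List (Node × Node) :=
  t.pairs.filter fun p => p.1 = p.2 ∨ ∃ s ∈ T, s.1 = p.1 ∧ ∃ e ∈ t.unit, e.1 = s.2 ∧ e.2 = p.2

/-- The pairs of nodes that are connected by a chain of unit productions. As many rounds as there
are pairs suffice; four times as many are made because the program that computes this list counts
the rounds by a stack with four entries for each pair. -/
def chains (t : Tables) : List (Node × Node) := t.chainStep^[t.pairs.length * 4] []

theorem mem_chainStep {t : Tables} {T : List (Node × Node)} {p : Node × Node} :
    p ∈ t.chainStep T ↔ p ∈ t.pairs ∧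
      (p.1 = p.2 ∨ ∃ s ∈ T, s.1 = p.1 ∧ ∃ e ∈ t.unit, e.1 = s.2 ∧ e.2 = p.2) := by
  simp [chainStep]

theorem chainStep_sublist {t : Tables} {T T' : List (Node × Node)} (h : T ⊆ T') :
    (t.chainStep T).Sublist (t.chainStep T') := by
  refine List.monotone_filter_right _ fun p hp => ?_
  simp only [decide_eq_true_eq] at hp ⊢
  rcases hp with hp | ⟨s, hs, hp⟩
  · exact .inl hp
  · exact .inr ⟨s, h hs, hp⟩

/-- The lists of the iteration grow inside the list of all pairs, so they become constant. -/
theorem chainStep_chains (t : Tables) : t.chainStep t.chains = t.chains := by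
  -- Each list is a sublist of the next one, so two that have equal lengths are equal.
  have hmono : ∀ n, (t.chainStep^[n] []).Sublist (t.chainStep^[n + 1] []) := by
    intro n
    induction n with
    | zero => exact List.nil_sublist _
    | succ n ih =>
      rw [Function.iterate_succ_apply', Function.iterate_succ_apply' _ (n + 1)]
      exact chainStep_sublist ih.subset
  have hle : ∀ n, (t.chainStep^[n] []).length ≤ t.pairs.length := by
    intro n
    cases n with
    | zero => simp
    | succ n =>
      rw [Function.iterate_succ_apply']
      exact List.length_filter_le _ _
  have hgrow : ∀ n, t.chainStep^[n + 1] [] = t.chainStep^[n] [] ∨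
      n ≤ (t.chainStep^[n] []).length := by
    intro n
    induction n with
    | zero => exact .inr (Nat.zero_le _)
    | succ n ih =>
      by_cases h : t.chainStep^[n + 1] [] = t.chainStep^[n] []
      · left
        rw [Function.iterate_succ_apply', h, ← Function.iterate_succ_apply' t.chainStep n []]
        exact h
      · have h1 := ih.resolve_left h
        have h2 := (hmono n).length_le
        have h3 : (t.chainStep^[n] []).length ≠ (t.chainStep^[n + 1] []).length := fun h3 =>
          h ((hmono n).eq_of_length h3).symm
        right
        omega
  rw [chains, ← Function.iterate_succ_apply' t.chainStep (t.pairs.length * 4) []]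
  rcases hgrow (t.pairs.length * 4) with h | h
  · exact h
  · refine ((hmono _).eq_of_length_le ?_).symm
    have := hle (t.pairs.length * 4 + 1)
    omega

theorem mem_chains {t : Tables} {A X : Node} :
    (A, X) ∈ t.chains ↔ A ∈ t.nodes ∧ X ∈ t.nodes ∧ t.Chain A X := by
  constructor
  · have : ∀ n, ∀ p ∈ t.chainStep^[n] [], p.1 ∈ t.nodes ∧ p.2 ∈ t.nodes ∧ t.Chain p.1 p.2 := by
      intro n
      induction n with
      | zero => simp
      | succ n ih =>
        intro p hp
        rw [Function.iterate_succ_apply', mem_chainStep, mem_pairs] at hp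
        refine ⟨hp.1.1, hp.1.2, ?_⟩
        rcases hp.2 with h | ⟨s, hs, h1, e, he, h2, h3⟩
        · rw [h]
          exact .refl
        · have := (ih s hs).2.2
          rw [h1, ← h2] at this
          rw [← h3]
          exact this.tail he
    exact this _ (A, X)
  · rintro ⟨hA, hX, h⟩
    induction h with
    | refl =>
      rw [← chainStep_chains, mem_chainStep, mem_pairs]
      exact ⟨⟨hA, hX⟩, .inl rfl⟩
    | tail _ h ih =>
      rw [← chainStep_chains, mem_chainStep, mem_pairs]
      exact ⟨⟨hA, hX⟩, .inr ⟨_, ih (mem_nodes_of_unit h).1, rfl, _, h, rfl, rfl⟩⟩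

end Tables

/-! ### The normal form -/

namespace Tables

/-- References to the words `w` with `t.Corner Z W w`: `(0, 0)` stands for the empty word, and
`(1, i)` for the nonterminal `i`, the index of the pair `(Z, W)`. -/
def references (t : Tables) (Z W : Node) : List Node :=
  t.chains.flatMap (fun s => if s = (Z, W) then [(0, 0)] else []) ++
    t.pairs.zipIdx.flatMap (fun p => if p.1 = (Z, W) then [(1, p.2)] else [])

/-- The nonterminal in a reference, if there is one. -/
def refSymbols (o : Node) : List ℕ := if o.1 = 1 then [o.2] else []

/-- The productions of the normal form. The entry `((a, q), o₁, o₂)` stands for the production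
`q → a o₁ o₂`, where `q` is the index of a pair `(A, X)`. A word `w` with `t.Corner A X w` comes
from a binary production `C → X' Y` with a chain from `X'` to `X`: `a` is the first letter of the
word of `Y`, `o₁` refers to the rest of this word, and `o₂` to a word of `t.Corner A C`. -/
def greibachRules (t : Tables) : List (Node × Node × Node) :=
  t.pairs.zipIdx.flatMap fun p => t.binary.flatMap fun e => t.chains.flatMap fun s =>
    if s = (e.2.1, p.1.2) then t.nodes.flatMap fun n =>
      if n.1 = 0 then (t.references e.2.2 n).flatMap fun o₁ =>
        (t.references p.1.1 e.1).flatMap fun o₂ => [((n.2, p.2), o₁, o₂)]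
      else []
    else []

/-- The indices of the productions that stem from the letter `a`. -/
def letters (t : Tables) (a : ℕ) : List ℕ :=
  t.greibachRules.zipIdx.flatMap fun r => if r.1.1.1 = a then [r.2] else []

theorem mem_letters {t : Tables} {a i : ℕ} :
    i ∈ t.letters a ↔ ∃ r, t.greibachRules[i]? = some r ∧ r.1.1 = a := by
  simp only [letters, List.mem_flatMap, List.mem_ite_nil_right, Prod.exists,
    List.mem_zipIdx_iff_getElem?, List.mem_singleton]
  aesop

theorem mem_references {t : Tables} {Z W o : Node} :
    o ∈ t.references Z W ↔ (o = (0, 0) ∧ (Z, W) ∈ t.chains) ∨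
      (o.1 = 1 ∧ t.pairs[o.2]? = some (Z, W)) := by
  obtain ⟨f, i⟩ := o
  simp only [references, List.mem_append, List.mem_flatMap, List.mem_ite_nil_right, Prod.exists,
    List.mem_zipIdx_iff_getElem?, List.mem_singleton]
  aesop

theorem mem_greibachRules {t : Tables} {a q : ℕ} {o₁ o₂ : Node} :
    ((a, q), o₁, o₂) ∈ t.greibachRules ↔ ∃ A X C X' Y, t.pairs[q]? = some (A, X) ∧
      (C, X', Y) ∈ t.binary ∧ (X', X) ∈ t.chains ∧ (0, a) ∈ t.nodes ∧
      o₁ ∈ t.references Y (0, a) ∧ o₂ ∈ t.references A C := by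
  simp only [greibachRules, List.mem_flatMap, List.mem_ite_nil_right, List.mem_singleton]
  constructor
  · rintro ⟨⟨⟨A, X⟩, i⟩, hp, ⟨C, X', Y⟩, hB, s, hs, rfl, ⟨n₁, n₂⟩, hn, rfl, o, ho₁, o', ho₂, h⟩
    cases h
    exact ⟨A, X, C, X', Y, List.mem_zipIdx_iff_getElem?.1 hp, hB, hs, hn, ho₁, ho₂⟩
  · rintro ⟨A, X, C, X', Y, hp, hB, hs, hn, ho₁, ho₂⟩
    exact ⟨((A, X), q), List.mem_zipIdx_iff_getElem?.2 hp, _, hB, _, hs, rfl, _, hn, rfl, _, ho₁, _,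
      ho₂, rfl⟩

end Tables

/-- The production with number `i` of the normal form. Its terminal is its number. -/
def greibachRule (r : Node × Node × Node) (i : ℕ) : ContextFreeRule ℕ ℕ where
  input := r.1.2
  output := .terminal i :: (Tables.refSymbols r.2.1 ++ Tables.refSymbols r.2.2).map .nonterminal

/-- The normal form of a grammar. The start symbol is the index of the pair of `(3, 1)` and
`(3, 0)`. -/
def CFG.greibach (H : CFG) : CFG where
  start := 1
  prods := H.tables.greibachRules.zipIdx.map fun r => greibachRule r.1 r.2
  output_ne_nil := by
    intro p hp
    obtain ⟨r, -, rfl⟩ := List.mem_map.1 hp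
    exact List.cons_ne_nil _ _

theorem CFG.mem_greibach_prods {H : CFG} {p : ContextFreeRule ℕ ℕ} :
    p ∈ H.greibach.prods ↔ ∃ r i, H.tables.greibachRules[i]? = some r ∧ p = greibachRule r i := by
  simp only [CFG.greibach, List.mem_map]
  constructor
  · rintro ⟨⟨r, i⟩, h, rfl⟩
    exact ⟨r, i, List.mem_zipIdx_iff_getElem?.1 h, rfl⟩
  · rintro ⟨r, i, h, rfl⟩
    exact ⟨(r, i), List.mem_zipIdx_iff_getElem?.2 h, rfl⟩

theorem CFG.isSimple_greibach (H : CFG) : H.greibach.IsSimple := by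
  constructor
  · intro p hp
    obtain ⟨r, i, h, rfl⟩ := CFG.mem_greibach_prods.1 hp
    exact ⟨_, _, rfl⟩
  · intro p hp q hq a _ hpa hqa
    obtain ⟨r, i, h, rfl⟩ := CFG.mem_greibach_prods.1 hp
    obtain ⟨r', j, h', rfl⟩ := CFG.mem_greibach_prods.1 hq
    simp only [greibachRule, List.head?_cons, Option.some.injEq, Symbol.terminal.injEq] at hpa hqa
    subst hpa
    subst hqa
    rw [h] at h'
    injection h' with h'
    rw [h']

/-! ### The language of the normal form -/

/-- `x` is a possible assignment for the word `w`. -/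
def CFG.Matches (H : CFG) (x w : List ℕ) : Prop :=
  List.Forall₂ (fun i a => i ∈ H.tables.letters a) x w

/-- A nonterminal of the normal form that is the index of the pair `(A, X)` derives, up to the names
of the letters, the words `w` with `Corner A X w`, apart from the empty one. -/
theorem CFG.yields_of_corner (H : CFG) {A X : Node} {w : List ℕ} {q : ℕ}
    (h : H.tables.Corner A X w) (hq : H.tables.pairs[q]? = some (A, X)) (hw : w ≠ []) :
    ∃ x, H.Matches x w ∧ H.greibach.Yields [.nonterminal q] x := by
  induction hn : w.length using Nat.strong_induction_on generalizing A X w q with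
  | _ n ih =>
    set t := H.tables with ht
    -- Words shorter than `w`, including the empty one, have references.
    have href : ∀ {Z W u}, t.Corner Z W u → Z ∈ t.nodes → W ∈ t.nodes → u.length < n →
        ∃ o ∈ t.references Z W, ∃ x, H.Matches x u ∧
          H.greibach.Yields ((Tables.refSymbols o).map .nonterminal) x := by
      intro Z W u hu hZ hW hlen
      rcases eq_or_ne u [] with rfl | hne
      · refine ⟨(0, 0), Tables.mem_references.2 (.inl ⟨rfl, ?_⟩), [], .nil, .nil⟩
        generalize hu' : ([] : List ℕ) = u' at hu
        cases hu with
        | nil h => exact Tables.mem_chains.2 ⟨hZ, hW, h⟩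
        | cons hB _ hu hv =>
          obtain ⟨a, v, rfl, -⟩ := hu.exists_corner (Tables.mem_nodes_of_binary hB).2.2
          simp at hu'
      · obtain ⟨i, hi⟩ := List.mem_iff_getElem?.1
          (Tables.mem_pairs.2 ⟨hZ, hW⟩ : (Z, W) ∈ t.pairs)
        obtain ⟨x, hx, hy⟩ := ih _ hlen hu hi hne rfl
        exact ⟨(1, i), Tables.mem_references.2 (.inr ⟨rfl, hi⟩), x, hx, hy⟩
    have hAX := Tables.mem_pairs.1 (List.mem_of_getElem? hq)
    cases h with
    | nil _ => exact absurd rfl hw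
    -- The first step up the leftmost branch: the first letter of `w` starts the word of `Y`.
    | @cons C _ X' Y u v hB hX hu hv =>
      obtain ⟨hC, hX', hY⟩ := Tables.mem_nodes_of_binary hB
      obtain ⟨a, u', rfl, ha, hu'⟩ := hu.exists_corner hY
      simp only [List.cons_append, List.length_cons, List.length_append] at hn
      obtain ⟨o₁, ho₁, x₁, hx₁, hy₁⟩ := href hu' hY ha (by omega)
      obtain ⟨o₂, ho₂, x₂, hx₂, hy₂⟩ := href hv hAX.1 hC (by omega)
      have hr : ((a, q), o₁, o₂) ∈ t.greibachRules := Tables.mem_greibachRules.2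
        ⟨A, X, C, X', Y, hq, hB, Tables.mem_chains.2 ⟨hX', hAX.2, hX⟩, ha, ho₁, ho₂⟩
      obtain ⟨i, hi⟩ := List.mem_iff_getElem?.1 hr
      refine ⟨i :: (x₁ ++ x₂), ?_, ?_⟩
      · exact .cons (Tables.mem_letters.2 ⟨_, hi, rfl⟩) (List.rel_append hx₁ hx₂)
      · refine CFG.yields_nonterminal.2 ⟨_, CFG.mem_greibach_prods.2 ⟨_, i, hi, rfl⟩, rfl, ?_⟩
        rw [greibachRule, List.map_append]
        exact .terminal (hy₁.append hy₂)

/-- The words that a sequence of symbols of the normal form stands for. -/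
def CFG.Stands (H : CFG) : List (Symbol ℕ ℕ) → List ℕ → Prop
  | [], w => w = []
  | .terminal i :: l, w => ∃ a v, w = a :: v ∧ i ∈ H.tables.letters a ∧ H.Stands l v
  | .nonterminal q :: l, w => ∃ A X u v, w = u ++ v ∧ H.tables.pairs[q]? = some (A, X) ∧
      H.tables.Corner A X u ∧ H.Stands l v

theorem CFG.Stands.of_references {H : CFG} {Z W o : Node} (ho : o ∈ H.tables.references Z W)
    {l : List (Symbol ℕ ℕ)} {w : List ℕ}
    (h : H.Stands ((Tables.refSymbols o).map .nonterminal ++ l) w) :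
    ∃ u v, w = u ++ v ∧ H.tables.Corner Z W u ∧ H.Stands l v := by
  rcases Tables.mem_references.1 ho with ⟨rfl, hc⟩ | ⟨h1, h2⟩
  · exact ⟨[], w, rfl, .nil (Tables.mem_chains.1 hc).2.2, h⟩
  · rw [Tables.refSymbols, if_pos h1] at h
    obtain ⟨A, X, u, v, rfl, hp, hu, hv⟩ := h
    rw [h2] at hp
    cases hp
    exact ⟨u, v, rfl, hu, hv⟩

theorem CFG.stands_of_yields {H : CFG} {l : List (Symbol ℕ ℕ)} {x w : List ℕ}
    (h : H.greibach.Yields l x) (hw : H.Matches x w) : H.Stands l w := by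
  induction h generalizing w with
  | nil => cases hw; rfl
  | terminal _ ih =>
    cases hw with
    | cons h hw => exact ⟨_, _, rfl, h, ih hw⟩
  | @nonterminal p l u v hp _ _ ih₁ ih₂ =>
    obtain ⟨⟨⟨a, q⟩, o₁, o₂⟩, i, hi, rfl⟩ := CFG.mem_greibach_prods.1 hp
    obtain ⟨w₁, w₂, h₁, h₂, rfl⟩ : ∃ w₁ w₂, H.Matches u w₁ ∧ H.Matches v w₂ ∧ w = w₁ ++ w₂ :=
      ⟨w.take u.length, w.drop u.length, (List.forall₂_take_append _ _ _ hw.flip).flip,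
        (List.forall₂_drop_append _ _ _ hw.flip).flip, (List.take_append_drop _ _).symm⟩
    have hs := ih₁ h₁
    simp only [greibachRule, List.map_append] at hs
    obtain ⟨a', w', rfl, ha, hs⟩ := hs
    obtain ⟨r, hr, rfl⟩ := Tables.mem_letters.1 ha
    rw [hi] at hr
    cases hr
    obtain ⟨A, X, C, X', Y, hq, hB, hX, -, ho₁, ho₂⟩ :=
      Tables.mem_greibachRules.1 (List.mem_of_getElem? hi)
    obtain ⟨u₁, v₁, rfl, hu₁, hs⟩ := CFG.Stands.of_references ho₁ hs
    rw [← List.append_nil (List.map _ _)] at hs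
    obtain ⟨u₂, v₂, rfl, hu₂, hs⟩ := CFG.Stands.of_references ho₂ hs
    obtain rfl : v₂ = [] := hs
    refine ⟨A, X, a :: (u₁ ++ (u₂ ++ [])), w₂, rfl, hq, ?_, ih₂ h₂⟩
    rw [List.append_nil]
    exact .cons (u := a :: u₁) hB (Tables.mem_chains.1 hX).2.2 (hu₁.gen (.leaf a)) hu₂

/-- The leftmost branch of a derivation tree with the root `(3, 1)` cannot reach `(3, 0)` but by the
production `(3, 1) → (3, 0) S`. -/
theorem CFG.corner_start_iff (H : CFG) {w : List ℕ} (hw : w ≠ []) :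
    H.tables.Corner (3, 1) (3, 0) w ↔ H.tables.Gen (1, H.start) w := by
  obtain ⟨sufs, hs⟩ := H.exists_sound_tables
  have hchain : ∀ {A : Node} {i}, H.tables.Chain A (3, i) → A = (3, i) := by
    intro A i h
    rcases Relation.ReflTransGen.cases_tail h with h | ⟨Z, -, h⟩
    · exact h.symm
    · obtain ⟨x, hx, -⟩ := hs.unit_mem _ h
      cases x <;> simp [symbolNode] at hx
  have hbin : ∀ {C Y : Node} {i}, (C, (3, i), Y) ∈ H.tables.binary →
      (C, (3, i), Y) = startTriple H := by
    intro C Y i h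
    rcases hs.binary_mem _ h with h | ⟨x, l, hx, -⟩
    · exact h
    · cases x <;> simp [symbolNode] at hx
  constructor
  · intro h
    cases h with
    | nil h => exact absurd rfl hw
    | cons hB hX hu hv =>
      obtain rfl := hchain hX
      have := hbin hB
      simp only [startTriple, Prod.mk.injEq] at this
      obtain ⟨rfl, -, rfl⟩ := this
      cases hv with
      | nil h => simpa using hu
      | cons hB' hX' _ _ =>
        obtain rfl := hchain hX'
        have := hbin hB'
        simp [startTriple] at this
  · intro h
    rw [← List.append_nil w]
    exact .cons ((sub_scanProds _ _).2 List.mem_cons_self) .refl h (.nil .refl)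

theorem CFG.pairs_one (H : CFG) : H.tables.pairs[1]? = some ((3, 1), (3, 0)) := by
  simp [Tables.pairs, Tables.nodes]

theorem CFG.mem_language_iff_exists_matches (H : CFG) (w : List ℕ) :
    w ∈ H.language ↔ ∃ x, H.Matches x w ∧ x ∈ H.greibach.language := by
  simp only [CFG.mem_language (G := H.greibach)]
  constructor
  · intro h
    rw [← CFG.gen_tables_iff] at h
    have hw : w ≠ [] := by
      have : (1, H.start) ∈ H.tables.nodes := (Tables.mem_nodes_of_binary
        ((sub_scanProds _ _).2 List.mem_cons_self : startTriple H ∈ H.tables.binary)).2.2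
      obtain ⟨a, v, rfl, -⟩ := h.exists_corner this
      simp
    exact H.yields_of_corner ((H.corner_start_iff hw).2 h) H.pairs_one hw
  · rintro ⟨x, hx, h⟩
    have hne : w ≠ [] := by
      rintro rfl
      cases hx
      obtain ⟨p, hp, -, h⟩ := CFG.yields_nonterminal.1 h
      obtain ⟨r, i, -, rfl⟩ := CFG.mem_greibach_prods.1 hp
      cases h
    obtain ⟨A, X, u, v, rfl, hp, hc, hv⟩ := CFG.stands_of_yields h hx
    obtain rfl : v = [] := hv
    change H.tables.pairs[1]? = _ at hp
    rw [H.pairs_one] at hp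
    cases hp
    rw [List.append_nil] at hne ⊢
    rw [← CFG.gen_tables_iff]
    exact (H.corner_start_iff hne).1 hc

/-- The domains of the variables. -/
def CFG.domains (H : CFG) (s : List ℕ) (i : Fin s.length) : List ℕ := H.tables.letters (s.get i)

/-- A string belongs to the language of a grammar if and only if the domains admit a word of its
normal form. -/
theorem CFG.mem_language_iff_not_disentailed (H : CFG) (s : List ℕ) :
    s ∈ H.language ↔ ¬ Disentailed (H.domains s) H.greibach := by
  rw [H.mem_language_iff_exists_matches, Disentailed, not_not]
  constructor
  · rintro ⟨x, hx, h⟩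
    have hlen := hx.length_eq
    refine ⟨fun i => x.get (i.cast hlen.symm), fun i => ?_, ?_⟩
    · exact (List.forall₂_iff_get.1 hx).2 i _ i.2
    · have : List.ofFn (fun i : Fin s.length => x.get (i.cast hlen.symm)) = x := by
        apply List.ext_get
        · simp [hlen]
        · intro n h1 h2
          simp
      rw [GrammarConstraint, this]
      exact h
  · rintro ⟨X, hX, h⟩
    refine ⟨List.ofFn X, List.forall₂_iff_get.2 ⟨by simp, fun i h1 h2 => ?_⟩, h⟩
    rw [List.get_ofFn]
    exact hX ⟨i, h2⟩

/-! ### Tables as lists of numbers -/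

/-- A node as a list of numbers. -/
def flat₂ (n : Node) : List ℕ := [n.1, n.2]

/-- A pair of nodes as a list of numbers. -/
def flat₄ (p : Node × Node) : List ℕ := [p.1.1, p.1.2, p.2.1, p.2.2]

/-- A triple of nodes as a list of numbers. -/
def flat₆ (e : Node × Node × Node) : List ℕ :=
  [e.1.1, e.1.2, e.2.1.1, e.2.1.2, e.2.2.1, e.2.2.2]

theorem length_flat₂ (n : Node) : (flat₂ n).length = 2 := rfl

theorem length_flat₄ (p : Node × Node) : (flat₄ p).length = 4 := rfl

theorem length_flat₆ (e : Node × Node × Node) : (flat₆ e).length = 6 := rfl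

theorem length_flatMap_of_length_eq {α : Type} {enc : α → List ℕ} {k : ℕ}
    (henc : ∀ a, (enc a).length = k) (l : List α) : (l.flatMap enc).length = l.length * k := by
  induction l with
  | nil => simp
  | cons a l ih => rw [List.flatMap_cons, List.length_append, henc, ih, List.length_cons]; ring

theorem take_drop_flatMap {α : Type} {enc : α → List ℕ} {k : ℕ}
    (henc : ∀ a, (enc a).length = k) (l : List α) (j : ℕ) (hj : j < l.length) :
    ((l.flatMap enc).drop (j * k)).take k = enc l[j] := by
  induction l generalizing j with
  | nil => simp at hj
  | cons a l ih =>
    rw [List.flatMap_cons]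
    cases j with
    | zero => simp [← henc a]
    | succ j =>
      have : (j + 1) * k = (enc a).length + j * k := by rw [henc]; ring
      rw [this, List.drop_append, List.getElem_cons_succ, ← ih j (by simpa using hj)]
      simp [List.drop_eq_nil_of_le]

namespace Expr

/-- The value of `each` on a table. -/
theorem eval_each {α : Type} {enc : α → List ℕ} {d k x : ℕ} {e : Expr} {σ : Store} (hk : 1 ≤ k)
    (henc : ∀ a, (enc a).length = k) {l : List α} (hx : σ x = l.flatMap enc)
    {f : α × ℕ → List ℕ} (hf : ∀ a j, e.eval (bindBlock σ d j (enc a)) = f (a, j)) :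
    (each d k x e).eval σ = l.zipIdx.flatMap f := by
  have hn : ((σ x).length + k - 1) / k = l.length := by
    rw [hx, length_flatMap_of_length_eq henc, Nat.add_sub_assoc hk, mul_comm,
      Nat.mul_add_div (by omega), Nat.div_eq_of_lt (by omega), add_zero]
  rw [eval, hn, List.flatMap_def, List.flatMap_def]
  congr 1
  apply List.ext_getElem
  · simp
  · intro j h1 h2
    have hj : j < l.length := by simpa using h1
    simp only [List.getElem_map, List.getElem_range, List.getElem_zipIdx, Nat.zero_add]
    rw [hx, take_drop_flatMap henc l j hj, hf]

theorem eval_each' {α : Type} {enc : α → List ℕ} {d k x : ℕ} {e : Expr} {σ : Store} (hk : 1 ≤ k)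
    (henc : ∀ a, (enc a).length = k) {l : List α} (hx : σ x = l.flatMap enc)
    {f : α → List ℕ} (hf : ∀ a j, e.eval (bindBlock σ d j (enc a)) = f a) :
    (each d k x e).eval σ = l.flatMap f := by
  rw [eval_each hk henc hx (f := fun p => f p.1) hf]
  have : l.zipIdx.flatMap (fun p => f p.1) = (l.zipIdx.map Prod.fst).flatMap f := by
    rw [List.flatMap_map]
  rw [this, List.zipIdx_map_fst]

/-- The elements of the list. -/
def ofVars (xs : List ℕ) : Expr := xs.foldr (fun x e => app (hd x) e) nil

theorem eval_ofVars (xs : List ℕ) (σ : Store) :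
    (ofVars xs).eval σ = xs.flatMap fun x => (σ x).take 1 := by
  induction xs with
  | nil => rfl
  | cons x xs ih => simp only [ofVars, List.foldr_cons, eval] at ih ⊢; rw [ih, List.flatMap_cons]

theorem ok_ofVars {xs : List ℕ} {A : ℕ → Prop} {m : ℕ} : (ofVars xs).Ok A m ↔ ∀ x ∈ xs, A x := by
  induction xs with
  | nil => simp [ofVars, Ok]
  | cons x xs ih => simp only [ofVars, List.foldr_cons, Ok] at ih ⊢; simp [ih]

/-- `e` if the nodes in the variables `a`, `a + 1` and `b`, `b + 1` are equal, and the empty list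
otherwise. -/
def ifNodesEq (a b : ℕ) (e : Expr) : Expr :=
  ite (.sameTop a b) (ite (.sameTop (a + 1) (b + 1)) e nil) nil

end Expr

/-- The variables `a` and `a + 1` hold the node `n`. -/
def HoldsNode (σ : Store) (a : ℕ) (n : Node) : Prop := σ a = [n.1] ∧ σ (a + 1) = [n.2]

theorem HoldsNode.bindBlock {σ : Store} {a : ℕ} {n : Node} (h : HoldsNode σ a n) {d : ℕ}
    (hd : a < d) (j : ℕ) (c : List ℕ) : HoldsNode (bindBlock σ d j c) a n :=
  ⟨(bindBlock_of_lt (by omega)).trans h.1, (bindBlock_of_lt (by omega)).trans h.2⟩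

theorem HoldsNode.update {σ : Store} {a : ℕ} {n : Node} (h : HoldsNode σ a n) {d : ℕ}
    (hd : a < d) (c : List ℕ) : HoldsNode (Function.update σ (d + 1) c) a n :=
  ⟨(Function.update_of_ne (by omega) _ _).trans h.1,
    (Function.update_of_ne (by omega) _ _).trans h.2⟩

/-- The entries of the last block. -/
theorem bindBlock_add {σ : Store} {d j : ℕ} {c : List ℕ} (i : ℕ) :
    bindBlock σ d j c (d + 2 + i) = (c.drop i).take 1 := by
  unfold bindBlock
  rw [if_neg (by omega), if_pos (by omega)]
  congr 2
  omega

theorem bindBlock_succ {σ : Store} {d j : ℕ} {c : List ℕ} : bindBlock σ d j c (d + 1) = [j] := by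
  unfold bindBlock
  rw [if_pos rfl]

theorem holdsNode_bindBlock {σ : Store} {d j : ℕ} {c : List ℕ} {n : Node} (i : ℕ)
    (h : (c.drop i).take 2 = [n.1, n.2]) : HoldsNode (bindBlock σ d j c) (d + 2 + i) n := by
  have h1 : (c.drop i).take 1 = [n.1] := by
    have := congrArg (List.take 1) h
    rwa [List.take_take] at this
  have h2 : (c.drop (i + 1)).take 1 = [n.2] := by
    have := congrArg (List.drop 1) h
    rwa [List.drop_take, List.drop_drop] at this
  exact ⟨(bindBlock_add i).trans h1, (bindBlock_add (i + 1)).trans h2⟩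

namespace Expr

theorem eval_ifNodesEq {a b : ℕ} {e : Expr} {σ : Store} {n n' : Node} (h : HoldsNode σ a n)
    (h' : HoldsNode σ b n') :
    (ifNodesEq a b e).eval σ = if n = n' then e.eval σ else [] := by
  simp only [ifNodesEq, eval, Test.Holds, h.1, h.2, h'.1, h'.2, List.head?_cons, Option.some.injEq]
  rw [← ite_and]
  exact if_congr Prod.ext_iff.symm rfl rfl

/-! ### The normal form as a comprehension -/

/-! The comprehensions read the productions of the binary form from the variables `5` and `6`. -/

/-- The list of all nodes. -/
def nodesExpr : Expr :=
  app (app (const 3) (app (const 1) (app (const 3) (const 0))))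
    (app (each 21 1 6 (hd 23)) (each 21 1 5 (hd 23)))

/-- All pairs of nodes, from the list of nodes in variable `21`. -/
def pairsExpr : Expr := each 23 2 21 (each 27 2 21 (ofVars [25, 26, 29, 30]))

/-- A non-empty list if and only if the pair in `32`, …, `35` belongs to the next list of chains
after the one in `28`. -/
def chainTestExpr : Expr :=
  app (ifNodesEq 32 34 (const 0))
    (each 38 4 28 (ifNodesEq 40 32 (each 44 4 5 (ifNodesEq 46 42 (ifNodesEq 48 34 (const 0))))))

/-- The next list of chains after the one in variable `28`, from the list of pairs in `23`. -/
def chainStepExpr : Expr :=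
  each 30 4 23 (bind 36 chainTestExpr (ite (.isEmpty 37) nil (ofVars [32, 33, 34, 35])))

/-- The list of chains. -/
def chainsExpr : Expr := iter 26 23 chainStepExpr

/-- The references for the pair of the nodes in `z` and `w`, from the lists of pairs in `23` and of
chains in `25`. -/
def referencesExpr (d z w : ℕ) : Expr :=
  app (each d 4 25 (ifNodesEq (d + 2) z (ifNodesEq (d + 4) w (app (const 0) (const 0)))))
    (each d 4 23 (ifNodesEq (d + 2) z (ifNodesEq (d + 4) w (app (const 1) (hd (d + 1))))))

/-- The productions of the normal form for the pair in `28`, …, `31` with the index in `27`, the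
binary production in `34`, …, `39` and the node in `48`, `49`. -/
def ruleExpr : Expr :=
  bind 50 (const 0) (ite (.sameTop 48 51)
    (bind 52 (referencesExpr 53 38 48) (bind 54 (referencesExpr 55 28 34)
      (each 56 2 53 (each 60 2 55 (ofVars [49, 27, 58, 59, 62, 63]))))) nil)

/-- The productions of the normal form, from the tables in `5`, `6`, `21`, `23` and `25`. -/
def rulesExpr : Expr :=
  each 26 4 23 (each 32 6 6 (each 40 4 25
    (ifNodesEq 42 36 (ifNodesEq 44 30 (each 46 2 21 ruleExpr)))))

/-- The productions of the normal form, from the binary form in the variables `5` and `6`. -/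
def greibachExpr : Expr := bind 20 nodesExpr (bind 22 pairsExpr (bind 24 chainsExpr rulesExpr))

theorem eval_single {d x y : ℕ} {σ : Store} (hy : y = d + 2) :
    (each d 1 x (hd y)).eval σ = σ x := by
  rw [eval_each' (enc := fun a => [a]) (l := σ x) le_rfl (fun _ => rfl) (by simp)
    (f := fun a => [a])]
  · simp
  · intro a j
    rw [hy]
    simp only [eval, bindBlock_add 0 (d := d)]
    rfl

theorem eval_nodesExpr {t : Tables} {σ : Store} (h5 : σ 5 = t.unit.flatMap flat₄)
    (h6 : σ 6 = t.binary.flatMap flat₆) : nodesExpr.eval σ = t.nodes.flatMap flat₂ := by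
  have e1 : (each 21 1 6 (hd 23)).eval σ = σ 6 := eval_single rfl
  have e2 : (each 21 1 5 (hd 23)).eval σ = σ 5 := eval_single rfl
  rw [nodesExpr, eval, eval.eq_4 _ (each 21 1 6 (hd 23)), e1, e2, h5, h6]
  simp only [Tables.nodes, eval, List.flatMap_cons, List.flatMap_append, List.flatMap_assoc]
  simp only [flat₂, List.flatMap_nil, List.append_nil, List.cons_append, List.nil_append]
  rfl

theorem eval_pairsExpr {t : Tables} {σ : Store} (h : σ 21 = t.nodes.flatMap flat₂) :
    pairsExpr.eval σ = t.pairs.flatMap flat₄ := by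
  rw [pairsExpr, eval_each' (by norm_num) length_flat₂ h
    (f := fun A => t.nodes.flatMap fun X => flat₄ (A, X))]
  · simp [Tables.pairs, List.flatMap_assoc]
  · intro A j
    refine eval_each' (by norm_num) length_flat₂ ((bindBlock_of_lt (by norm_num)).trans h) ?_
    intro X j'
    rw [eval_ofVars]
    simp [bindBlock, flat₂, flat₄]

theorem eval_chainTestExpr {t : Tables} {σ : Store} {T : List (Node × Node)} {p : Node × Node}
    (h5 : σ 5 = t.unit.flatMap flat₄) (hT : σ 28 = T.flatMap flat₄) (h1 : HoldsNode σ 32 p.1)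
    (h2 : HoldsNode σ 34 p.2) :
    chainTestExpr.eval σ = [] ↔
      ¬ (p.1 = p.2 ∨ ∃ s ∈ T, s.1 = p.1 ∧ ∃ e ∈ t.unit, e.1 = s.2 ∧ e.2 = p.2) := by
  have e1 : (each 38 4 28 (ifNodesEq 40 32 (each 44 4 5
      (ifNodesEq 46 42 (ifNodesEq 48 34 (const 0)))))).eval σ =
      T.flatMap fun s => if s.1 = p.1 then t.unit.flatMap fun e =>
        if e.1 = s.2 then if e.2 = p.2 then [0] else [] else [] else [] := by
    refine eval_each' (by norm_num) length_flat₄ hT ?_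
    intro s j
    have hs1 : HoldsNode (bindBlock σ 38 j (flat₄ s)) 40 s.1 := holdsNode_bindBlock 0 rfl
    have hs2 : HoldsNode (bindBlock σ 38 j (flat₄ s)) 42 s.2 := holdsNode_bindBlock 2 rfl
    rw [eval_ifNodesEq hs1 (h1.bindBlock (by norm_num) _ _)]
    congr 1
    refine eval_each' (by norm_num) length_flat₄ ((bindBlock_of_lt (by norm_num)).trans h5) ?_
    intro e j'
    rw [eval_ifNodesEq (n := e.1) (holdsNode_bindBlock 0 rfl) (hs2.bindBlock (by norm_num) _ _),
      eval_ifNodesEq (n := e.2) (holdsNode_bindBlock 2 rfl)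
        ((h2.bindBlock (by norm_num) _ _).bindBlock (by norm_num) _ _)]
    rfl
  rw [chainTestExpr, eval, e1, eval_ifNodesEq h1 h2]
  simp only [eval, List.append_eq_nil_iff, ite_eq_right_iff, List.flatMap_eq_nil_iff]
  simp only [List.cons_ne_nil, imp_false, not_or, not_exists, not_and]

theorem eval_chainStepExpr {t : Tables} {σ : Store} {T : List (Node × Node)}
    (h5 : σ 5 = t.unit.flatMap flat₄) (h23 : σ 23 = t.pairs.flatMap flat₄)
    (hT : σ 28 = T.flatMap flat₄) :
    chainStepExpr.eval σ = (t.chainStep T).flatMap flat₄ := by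
  rw [chainStepExpr, eval_each' (by norm_num) length_flat₄ h23
    (f := fun p => if p.1 = p.2 ∨ ∃ s ∈ T, s.1 = p.1 ∧ ∃ e ∈ t.unit, e.1 = s.2 ∧ e.2 = p.2
      then flat₄ p else [])]
  · rw [Tables.chainStep]
    induction t.pairs with
    | nil => rfl
    | cons p l ih =>
      rw [List.flatMap_cons, ih, List.filter_cons]
      simp only [decide_eq_true_eq]
      split_ifs <;> simp
  · intro p j
    have hp1 : HoldsNode (bindBlock σ 30 j (flat₄ p)) 32 p.1 := holdsNode_bindBlock 0 rfl
    have hp2 : HoldsNode (bindBlock σ 30 j (flat₄ p)) 34 p.2 := holdsNode_bindBlock 2 rfl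
    have := eval_chainTestExpr (t := t) (T := T) ((bindBlock_of_lt (by norm_num)).trans h5)
      ((bindBlock_of_lt (by norm_num)).trans hT) hp1 hp2
    simp only [eval, Test.Holds, Function.update_self]
    rw [if_congr this rfl rfl, ite_not]
    congr 1

theorem eval_chainsExpr {t : Tables} {σ : Store} (h5 : σ 5 = t.unit.flatMap flat₄)
    (h23 : σ 23 = t.pairs.flatMap flat₄) : chainsExpr.eval σ = t.chains.flatMap flat₄ := by
  have hlen : (σ 23).length = t.pairs.length * 4 := by
    rw [h23, length_flatMap_of_length_eq length_flat₄]
  rw [chainsExpr, eval, hlen, Tables.chains]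
  induction t.pairs.length * 4 with
  | zero => rfl
  | succ n ih =>
    rw [Function.iterate_succ_apply', Function.iterate_succ_apply', ih]
    exact eval_chainStepExpr ((Function.update_of_ne (by norm_num) _ _).trans h5)
      ((Function.update_of_ne (by norm_num) _ _).trans h23) (Function.update_self _ _ _)

theorem eval_referencesExpr {t : Tables} {σ : Store} {d z w : ℕ} {Z W : Node}
    (h23 : σ 23 = t.pairs.flatMap flat₄) (h25 : σ 25 = t.chains.flatMap flat₄)
    (hz : z < d) (hw : w < d) (hZ : HoldsNode σ z Z) (hW : HoldsNode σ w W) :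
    (referencesExpr d z w).eval σ = (t.references Z W).flatMap flat₂ := by
  have e1 : ∀ (e : Expr) (s : Node × Node) (j : ℕ),
      (ifNodesEq (d + 2) z (ifNodesEq (d + 4) w e)).eval (bindBlock σ d j (flat₄ s)) =
        if s = (Z, W) then e.eval (bindBlock σ d j (flat₄ s)) else [] := by
    intro e s j
    rw [eval_ifNodesEq (n := s.1) (holdsNode_bindBlock 0 rfl) (hZ.bindBlock hz _ _),
      eval_ifNodesEq (n := s.2) (holdsNode_bindBlock 2 rfl) (hW.bindBlock hw _ _), ← ite_and]
    exact if_congr (Prod.ext_iff (x := s) (y := (Z, W))).symm rfl rfl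
  rw [referencesExpr, eval,
    eval_each' (by norm_num) length_flat₄ h25 (f := fun s => if s = (Z, W) then [0, 0] else []),
    eval_each (by norm_num) length_flat₄ h23
      (f := fun p => if p.1 = (Z, W) then [1, p.2] else [])]
  · rw [Tables.references, List.flatMap_append, List.flatMap_assoc, List.flatMap_assoc]
    congr 1 <;> congr 1 <;> funext p <;> split_ifs <;> rfl
  · intro s j
    rw [e1]
    simp [eval, bindBlock_succ]
  · intro s j
    rw [e1]
    rfl

theorem eval_ruleExpr {t : Tables} {σ : Store} {A C Y n : Node} {q : ℕ}
    (h23 : σ 23 = t.pairs.flatMap flat₄) (h25 : σ 25 = t.chains.flatMap flat₄)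
    (hq : σ 27 = [q]) (hA : HoldsNode σ 28 A) (hC : HoldsNode σ 34 C) (hY : HoldsNode σ 38 Y)
    (hn : HoldsNode σ 48 n) :
    ruleExpr.eval σ = (if n.1 = 0 then (t.references Y n).flatMap fun o₁ =>
        (t.references A C).flatMap fun o₂ => [((n.2, q), o₁, o₂)] else []).flatMap flat₆ := by
  set σ₁ := Function.update σ 51 [0] with hσ₁
  have n1 : ∀ {a : ℕ} {N : Node}, a < 50 → HoldsNode σ a N → HoldsNode σ₁ a N :=
    fun ha h => HoldsNode.update (d := 50) h ha _
  have u1 : ∀ a < 50, σ₁ a = σ a := fun a ha => Function.update_of_ne (by omega) _ _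
  have r1 := eval_referencesExpr (t := t) (d := 53) ((u1 23 (by norm_num)).trans h23)
    ((u1 25 (by norm_num)).trans h25) (z := 38) (w := 48) (by norm_num) (by norm_num)
    (n1 (by norm_num) hY) (n1 (by norm_num) hn)
  set σ₂ := Function.update σ₁ 53 ((t.references Y n).flatMap flat₂) with hσ₂
  have n2 : ∀ {a : ℕ} {N : Node}, a < 50 → HoldsNode σ a N → HoldsNode σ₂ a N :=
    fun ha h => HoldsNode.update (d := 52) (n1 ha h) (by omega) _
  have u2 : ∀ a < 50, σ₂ a = σ a := fun a ha =>
    (Function.update_of_ne (by omega) _ _).trans (u1 a ha)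
  have r2 := eval_referencesExpr (t := t) (d := 55) ((u2 23 (by norm_num)).trans h23)
    ((u2 25 (by norm_num)).trans h25) (z := 28) (w := 34) (by norm_num) (by norm_num)
    (n2 (by norm_num) hA) (n2 (by norm_num) hC)
  set σ₃ := Function.update σ₂ 55 ((t.references A C).flatMap flat₂) with hσ₃
  have u3 : ∀ a < 50, σ₃ a = σ a := fun a ha =>
    (Function.update_of_ne (by omega) _ _).trans (u2 a ha)
  have h53 : σ₃ 53 = (t.references Y n).flatMap flat₂ :=
    (Function.update_of_ne (by norm_num) _ _).trans (Function.update_self _ _ _)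
  have h55 : σ₃ 55 = (t.references A C).flatMap flat₂ := Function.update_self _ _ _
  have r3 : (each 56 2 53 (each 60 2 55 (ofVars [49, 27, 58, 59, 62, 63]))).eval σ₃ =
      (t.references Y n).flatMap fun o₁ => (t.references A C).flatMap fun o₂ =>
        flat₆ ((n.2, q), o₁, o₂) := by
    refine eval_each' (by norm_num) length_flat₂ h53 fun o₁ j => ?_
    refine eval_each' (by norm_num) length_flat₂ ((bindBlock_of_lt (by norm_num)).trans h55)
      fun o₂ j' => ?_
    have h49 : σ₃ 49 = [n.2] := (u3 49 (by norm_num)).trans hn.2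
    have h27 : σ₃ 27 = [q] := (u3 27 (by norm_num)).trans hq
    rw [eval_ofVars]
    simp [bindBlock, flat₂, flat₆, h49, h27]
  have h48 : σ₁ 48 = [n.1] := (u1 48 (by norm_num)).trans hn.1
  have h51 : σ₁ 51 = [0] := Function.update_self _ _ _
  have hite : ruleExpr.eval σ = if n.1 = 0 then
      (each 56 2 53 (each 60 2 55 (ofVars [49, 27, 58, 59, 62, 63]))).eval σ₃ else [] := by
    rw [hσ₃, ← r2, hσ₂, ← r1]
    change (if (σ₁ 48).head? = (σ₁ 51).head? then _ else _) = _
    rw [h48, h51]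
    refine if_congr (by simp) rfl rfl
  rw [hite, r3]
  split_ifs
  · simp only [List.flatMap_assoc, List.flatMap_singleton]
  · rfl

theorem eval_rulesExpr {t : Tables} {σ : Store} (h6 : σ 6 = t.binary.flatMap flat₆)
    (h21 : σ 21 = t.nodes.flatMap flat₂) (h23 : σ 23 = t.pairs.flatMap flat₄)
    (h25 : σ 25 = t.chains.flatMap flat₄) :
    rulesExpr.eval σ = t.greibachRules.flatMap flat₆ := by
  rw [Tables.greibachRules]
  simp only [List.flatMap_assoc]
  refine eval_each (by norm_num) length_flat₄ h23 fun p q => ?_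
  set σ₁ := bindBlock σ 26 q (flat₄ p)
  have b1 : ∀ a < 27, σ₁ a = σ a := fun a ha => bindBlock_of_lt ha
  have hq : σ₁ 27 = [q] := bindBlock_succ
  have hA : HoldsNode σ₁ 28 p.1 := holdsNode_bindBlock 0 rfl
  have hX : HoldsNode σ₁ 30 p.2 := holdsNode_bindBlock 2 rfl
  refine eval_each' (by norm_num) length_flat₆ ((b1 6 (by norm_num)).trans h6) fun e j₂ => ?_
  set σ₂ := bindBlock σ₁ 32 j₂ (flat₆ e)
  have b2 : ∀ a < 33, σ₂ a = σ₁ a := fun a ha => bindBlock_of_lt ha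
  have hC : HoldsNode σ₂ 34 e.1 := holdsNode_bindBlock 0 rfl
  have hX' : HoldsNode σ₂ 36 e.2.1 := holdsNode_bindBlock 2 rfl
  have hY : HoldsNode σ₂ 38 e.2.2 := holdsNode_bindBlock 4 rfl
  refine eval_each' (by norm_num) length_flat₄
    ((b2 25 (by norm_num)).trans ((b1 25 (by norm_num)).trans h25)) fun s j₃ => ?_
  set σ₃ := bindBlock σ₂ 40 j₃ (flat₄ s)
  have b3 : ∀ a < 41, σ₃ a = σ₂ a := fun a ha => bindBlock_of_lt ha
  have hs1 : HoldsNode σ₃ 42 s.1 := holdsNode_bindBlock 0 rfl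
  have hs2 : HoldsNode σ₃ 44 s.2 := holdsNode_bindBlock 2 rfl
  rw [eval_ifNodesEq hs1 (hX'.bindBlock (by norm_num) _ _),
    eval_ifNodesEq hs2 ((hX.bindBlock (by norm_num) _ _).bindBlock (by norm_num) _ _), ← ite_and]
  have h21' : σ₃ 21 = t.nodes.flatMap flat₂ :=
    (b3 21 (by norm_num)).trans ((b2 21 (by norm_num)).trans ((b1 21 (by norm_num)).trans h21))
  have hev : (each 46 2 21 ruleExpr).eval σ₃ = (t.nodes.flatMap fun n =>
      if n.1 = 0 then (t.references e.2.2 n).flatMap fun o₁ =>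
        (t.references p.1 e.1).flatMap fun o₂ => [((n.2, q), o₁, o₂)] else []).flatMap flat₆ := by
    rw [List.flatMap_assoc]
    refine eval_each' (by norm_num) length_flat₂ h21' fun n j₄ => ?_
    have b4 : ∀ a < 27, bindBlock σ₃ 46 j₄ (flat₂ n) a = σ a := fun a ha =>
      (bindBlock_of_lt (by omega)).trans
        ((b3 a (by omega)).trans ((b2 a (by omega)).trans (b1 a ha)))
    refine eval_ruleExpr ((b4 23 (by norm_num)).trans h23) ((b4 25 (by norm_num)).trans h25) ?_
      (((hA.bindBlock (by norm_num) _ _).bindBlock (by norm_num) _ _).bindBlock (by norm_num) _ _)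
      ((hC.bindBlock (by norm_num) _ _).bindBlock (by norm_num) _ _)
      ((hY.bindBlock (by norm_num) _ _).bindBlock (by norm_num) _ _) (holdsNode_bindBlock 0 rfl)
    exact (bindBlock_of_lt (by norm_num)).trans
      ((b3 27 (by norm_num)).trans ((b2 27 (by norm_num)).trans hq))
  rw [if_congr (Prod.ext_iff (x := s) (y := (e.2.1, p.2))).symm hev rfl]
  split_ifs <;> rfl

/-- The comprehension computes the productions of the normal form. -/
theorem eval_greibachExpr {t : Tables} {σ : Store} (h5 : σ 5 = t.unit.flatMap flat₄)
    (h6 : σ 6 = t.binary.flatMap flat₆) :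
    greibachExpr.eval σ = t.greibachRules.flatMap flat₆ := by
  simp only [greibachExpr, eval]
  rw [eval_nodesExpr h5 h6]
  set σ₁ := Function.update σ (20 + 1) (t.nodes.flatMap flat₂)
  have u1 : ∀ a < 21, σ₁ a = σ a := fun a ha => Function.update_of_ne (by omega) _ _
  have h21 : σ₁ 21 = t.nodes.flatMap flat₂ := Function.update_self _ _ _
  rw [eval_pairsExpr h21]
  set σ₂ := Function.update σ₁ (22 + 1) (t.pairs.flatMap flat₄)
  have u2 : ∀ a < 23, σ₂ a = σ₁ a := fun a ha => Function.update_of_ne (by omega) _ _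
  have h23 : σ₂ 23 = t.pairs.flatMap flat₄ := Function.update_self _ _ _
  rw [eval_chainsExpr ((u2 5 (by norm_num)).trans ((u1 5 (by norm_num)).trans h5)) h23]
  set σ₃ := Function.update σ₂ (24 + 1) (t.chains.flatMap flat₄)
  have u3 : ∀ a < 25, σ₃ a = σ₂ a := fun a ha => Function.update_of_ne (by omega) _ _
  exact eval_rulesExpr ((u3 6 (by norm_num)).trans ((u2 6 (by norm_num)).trans
      ((u1 6 (by norm_num)).trans h6)))
    ((u3 21 (by norm_num)).trans ((u2 21 (by norm_num)).trans h21))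
    ((u3 23 (by norm_num)).trans h23) (Function.update_self _ _ _)

/-! ### The output as a comprehension -/

/-! The productions of the normal form are in variable `15`, and variable `4` holds the number `1`. -/

/-- The nonterminal of a reference as part of a right-hand side. -/
def symbolExpr (x : ℕ) : Expr :=
  ite (.sameTop x 4) (app (const 1) (app (const 1) (hd (x + 1)))) nil

/-- The encoding of the normal form. -/
def grammarExpr : Expr :=
  app (const 1) (app (each 20 6 15
    (app (app (const 1) (app (hd 23) (app (const 1) (app (const 0) (hd 21)))))
      (app (app (symbolExpr 24) (symbolExpr 26)) (const 0)))) (const 0))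

/-- The encoding of the domain of a variable as part of a list of domains, for the letter in
variable `8`. -/
def domainExpr : Expr :=
  app (const 1) (app (each 20 6 15 (ite (.sameTop 22 8) (app (const 1) (hd 21)) nil)) (const 0))

end Expr

theorem encodeList_eq {α : Type} (f : α → List ℕ) (l : List α) :
    encodeList f l = l.flatMap (fun x => 1 :: f x) ++ [0] := by
  induction l with
  | nil => rfl
  | cons x l ih => simp [encodeList, ih]

namespace Expr

theorem eval_symbolExpr {σ : Store} {x : ℕ} {o : Node} (h4 : σ 4 = [1]) (ho : HoldsNode σ x o) :
    (symbolExpr x).eval σ = ((Tables.refSymbols o).map Symbol.nonterminal).flatMap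
      fun s => 1 :: encodeSymbol s := by
  simp only [symbolExpr, eval, Test.Holds, h4, ho.1, ho.2, List.head?_cons, Option.some.injEq,
    Tables.refSymbols]
  split_ifs <;> simp [encodeSymbol]

theorem eval_grammarExpr {H : CFG} {σ : Store} (h4 : σ 4 = [1])
    (h15 : σ 15 = H.tables.greibachRules.flatMap flat₆) :
    grammarExpr.eval σ = encodeGrammar H.greibach := by
  have e1 : (each 20 6 15
      (app (app (const 1) (app (hd 23) (app (const 1) (app (const 0) (hd 21)))))
        (app (app (symbolExpr 24) (symbolExpr 26)) (const 0)))).eval σ =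
      H.tables.greibachRules.zipIdx.flatMap fun r =>
        1 :: encodeRule (greibachRule r.1 r.2) := by
    refine eval_each (by norm_num) length_flat₆ h15 fun r i => ?_
    have h4' : bindBlock σ 20 i (flat₆ r) 4 = [1] := (bindBlock_of_lt (by norm_num)).trans h4
    have s1 := eval_symbolExpr (o := r.2.1) h4' (holdsNode_bindBlock (d := 20) 2 rfl)
    have s2 := eval_symbolExpr (o := r.2.2) h4' (holdsNode_bindBlock (d := 20) 4 rfl)
    have h23 : bindBlock σ 20 i (flat₆ r) 23 = [r.1.2] := bindBlock_add (d := 20) 1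
    have h21 : bindBlock σ 20 i (flat₆ r) 21 = [i] := bindBlock_succ
    simp only [eval, h23, h21] at s1 s2 ⊢
    rw [s1, s2, encodeRule, encodeList_eq, greibachRule]
    simp [encodeSymbol, List.flatMap_append]
  simp only [eval] at e1
  simp only [grammarExpr, eval]
  rw [e1, encodeGrammar, encodeList_eq, CFG.greibach, List.flatMap_map]
  rfl

theorem eval_domainExpr {t : Tables} {σ : Store} {a : ℕ} (h8 : σ 8 = [a])
    (h15 : σ 15 = t.greibachRules.flatMap flat₆) :
    domainExpr.eval σ = 1 :: encodeString (t.letters a) := by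
  have e1 : (each 20 6 15 (ite (.sameTop 22 8) (app (const 1) (hd 21)) nil)).eval σ =
      t.greibachRules.zipIdx.flatMap fun r => if r.1.1.1 = a then [1, r.2] else [] := by
    refine eval_each (by norm_num) length_flat₆ h15 fun r i => ?_
    have h8' : bindBlock σ 20 i (flat₆ r) 8 = [a] := (bindBlock_of_lt (by norm_num)).trans h8
    have h22 : bindBlock σ 20 i (flat₆ r) 22 = [r.1.1] := bindBlock_add (d := 20) 0
    have h21 : bindBlock σ 20 i (flat₆ r) 21 = [i] := bindBlock_succ
    simp [eval, Test.Holds, h8', h22, h21]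
  simp only [eval] at e1
  simp only [domainExpr, eval]
  rw [e1, encodeString, encodeList_eq, Tables.letters, List.flatMap_assoc]
  simp only [List.singleton_append, List.cons.injEq, true_and]
  congr 2
  funext r
  split_ifs <;> rfl

/-! ### Resources of the comprehensions -/

theorem sum_length_blocks (l : List ℕ) (k n : ℕ) :
    ((List.range n).map fun j => ((l.drop (j * k)).take k).length).sum =
      (l.take (n * k)).length := by
  induction n with
  | zero => simp
  | succ n ih =>
    rw [List.range_succ, List.map_append, List.sum_append, ih, List.map_singleton,
      List.sum_singleton]
    simp only [List.length_take, List.length_drop, add_mul, one_mul]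
    omega

theorem length_chainStepExpr_le (σ : Store) : (chainStepExpr.eval σ).length ≤ (σ 23).length := by
  rw [chainStepExpr, eval, List.length_flatMap]
  refine (List.sum_le_sum (g := fun j => (((σ 23).drop (j * 4)).take 4).length) ?_).trans ?_
  · intro j _
    set c := ((σ 23).drop (j * 4)).take 4
    simp only [eval]
    split_ifs
    · simp
    · rw [eval_ofVars]
      have h : ∀ x, x < 36 → Function.update (bindBlock σ 30 j c) (36 + 1)
          (chainTestExpr.eval (bindBlock σ 30 j c)) x = bindBlock σ 30 j c x :=
        fun x hx => Function.update_of_ne (by omega) _ _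
      simp only [List.flatMap_cons, List.flatMap_nil, h 32 (by norm_num), h 33 (by norm_num),
        h 34 (by norm_num), h 35 (by norm_num), bindBlock_add (d := 30) 0,
        bindBlock_add (d := 30) 1, bindBlock_add (d := 30) 2, bindBlock_add (d := 30) 3,
        List.length_append, List.length_take, List.length_drop, List.length_nil]
      omega
  · rw [sum_length_blocks]
    exact List.length_take_le' _ _

theorem ok_greibachExpr : greibachExpr.Ok (fun x => x = 5 ∨ x = 6) 20 := by
  simp only [greibachExpr, nodesExpr, pairsExpr, chainsExpr, chainStepExpr, chainTestExpr,
    rulesExpr, ruleExpr, referencesExpr, ifNodesEq, Ok, Test.Reads, ok_ofVars]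
  simp
  exact length_chainStepExpr_le

theorem ok_grammarExpr : grammarExpr.Ok (fun x => x = 4 ∨ x = 15) 20 := by
  simp [grammarExpr, symbolExpr, Ok, Test.Reads]

theorem ok_domainExpr : domainExpr.Ok (fun x => x = 8 ∨ x = 15) 20 := by
  simp [domainExpr, Ok, Test.Reads]

end Expr

/-! ### Reading the grammar -/

/-- Execute the instructions one after the other. -/
def block : List Instr → Prog
  | [] => skip
  | c :: l => .instr c ;; block l

theorem Runs.block {l : List Instr} {σ τ : Store} (h : l.foldl (fun σ c => c.run σ) σ = τ)
    (hτ : Ready τ) : Runs (block l) σ τ (l.length + 1) := by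
  induction l generalizing σ with
  | nil =>
    obtain rfl : σ = τ := h
    exact Runs.skip hτ
  | cons c l ih => exact ((Runs.instr c σ).seq (ih h)).mono (by simp only [List.length_cons]; omega)

/-- The stores that occur while the grammar is read: the rest of the input, the tables, the next
number of a suffix, the current node, and the current symbol. -/
def readStore (inp u b : List ℕ) (n : ℕ) (k₁ k₂ s₁ s₂ : List ℕ) : Store
  | 0 => inp
  | 4 => [1]
  | 5 => u
  | 6 => b
  | 9 => [n]
  | 10 => k₁
  | 11 => k₂
  | 12 => s₁
  | 13 => s₂
  | _ => []

section
variable (inp u b : List ℕ) (n : ℕ) (k₁ k₂ s₁ s₂ v : List ℕ)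

theorem ready_readStore : Ready (readStore inp u b n k₁ k₂ s₁ s₂) := ⟨rfl, rfl⟩

theorem readStore_of_le {y : ℕ} (hy : 14 ≤ y) : readStore inp u b n k₁ k₂ s₁ s₂ y = [] := by
  obtain ⟨y, rfl⟩ := Nat.exists_eq_add_of_le' hy
  rfl

theorem update_readStore_0 : Function.update (readStore inp u b n k₁ k₂ s₁ s₂) 0 v =
    readStore v u b n k₁ k₂ s₁ s₂ := by
  funext y; rw [Function.update_apply]; split_ifs with h
  · rw [h]; rfl
  · unfold readStore; split <;> first | rfl | exact absurd rfl h

theorem update_readStore_5 : Function.update (readStore inp u b n k₁ k₂ s₁ s₂) 5 v =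
    readStore inp v b n k₁ k₂ s₁ s₂ := by
  funext y; rw [Function.update_apply]; split_ifs with h
  · rw [h]; rfl
  · unfold readStore; split <;> first | rfl | exact absurd rfl h

theorem update_readStore_6 : Function.update (readStore inp u b n k₁ k₂ s₁ s₂) 6 v =
    readStore inp u v n k₁ k₂ s₁ s₂ := by
  funext y; rw [Function.update_apply]; split_ifs with h
  · rw [h]; rfl
  · unfold readStore; split <;> first | rfl | exact absurd rfl h

theorem update_readStore_9 (m : ℕ) : Function.update (readStore inp u b n k₁ k₂ s₁ s₂) 9 [m] =
    readStore inp u b m k₁ k₂ s₁ s₂ := by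
  funext y; rw [Function.update_apply]; split_ifs with h
  · rw [h]; rfl
  · unfold readStore; split <;> first | rfl | exact absurd rfl h

theorem update_readStore_10 : Function.update (readStore inp u b n k₁ k₂ s₁ s₂) 10 v =
    readStore inp u b n v k₂ s₁ s₂ := by
  funext y; rw [Function.update_apply]; split_ifs with h
  · rw [h]; rfl
  · unfold readStore; split <;> first | rfl | exact absurd rfl h

theorem update_readStore_11 : Function.update (readStore inp u b n k₁ k₂ s₁ s₂) 11 v =
    readStore inp u b n k₁ v s₁ s₂ := by
  funext y; rw [Function.update_apply]; split_ifs with h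
  · rw [h]; rfl
  · unfold readStore; split <;> first | rfl | exact absurd rfl h

theorem update_readStore_12 : Function.update (readStore inp u b n k₁ k₂ s₁ s₂) 12 v =
    readStore inp u b n k₁ k₂ v s₂ := by
  funext y; rw [Function.update_apply]; split_ifs with h
  · rw [h]; rfl
  · unfold readStore; split <;> first | rfl | exact absurd rfl h

theorem update_readStore_13 : Function.update (readStore inp u b n k₁ k₂ s₁ s₂) 13 v =
    readStore inp u b n k₁ k₂ s₁ v := by
  funext y; rw [Function.update_apply]; split_ifs with h
  · rw [h]; rfl
  · unfold readStore; split <;> first | rfl | exact absurd rfl h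

theorem readStore_0 : readStore inp u b n k₁ k₂ s₁ s₂ 0 = inp := rfl
theorem readStore_5 : readStore inp u b n k₁ k₂ s₁ s₂ 5 = u := rfl
theorem readStore_6 : readStore inp u b n k₁ k₂ s₁ s₂ 6 = b := rfl
theorem readStore_9 : readStore inp u b n k₁ k₂ s₁ s₂ 9 = [n] := rfl
theorem readStore_10 : readStore inp u b n k₁ k₂ s₁ s₂ 10 = k₁ := rfl
theorem readStore_11 : readStore inp u b n k₁ k₂ s₁ s₂ 11 = k₂ := rfl
theorem readStore_12 : readStore inp u b n k₁ k₂ s₁ s₂ 12 = s₁ := rfl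
theorem readStore_13 : readStore inp u b n k₁ k₂ s₁ s₂ 13 = s₂ := rfl

end

/-- Read the symbols of a right-hand side and add productions to the tables. The current node is in
the stacks `10` and `11`. -/
def readOutput : Prog :=
  .while (.sameTop 0 4)
    (block [.pop 0, .copy 0 12, .pop 0, .copy 0 13, .pop 0] ;;
      .ite (.sameTop 0 4)
        (block [.copy 9 6, .push 6 2, .copy 13 6, .copy 12 6, .copy 11 6, .copy 10 6, .pop 10,
          .push 10 2, .pop 11, .copy 9 11, .inc 9, .pop 12, .pop 13])
        (block [.copy 13 5, .copy 12 5, .copy 11 5, .copy 10 5, .pop 12, .pop 13]))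

/-- Read the productions and add their binary forms to the tables. -/
def readProds : Prog :=
  .while (.sameTop 0 4)
    (block [.pop 0, .push 10 1, .copy 0 11, .pop 0] ;; readOutput ;;
      block [.pop 0, .pop 10, .pop 11])

/-- Read the grammar. At the start, stack `6` receives the production `(3, 1) → (3, 0) S` of
`startTriple`, last entry first. -/
def readGrammar : Prog :=
  block [.push 4 1, .push 9 0, .copy 0 6, .push 6 1, .push 6 0, .push 6 3, .push 6 1, .push 6 3,
    .pop 0] ;; readProds ;; .instr (.pop 0)

/-- The store that holds the tables. -/
def tableStore (inp : List ℕ) (t : Tables) (k₁ k₂ : List ℕ) : Store :=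
  readStore inp (t.unit.flatMap flat₄) (t.binary.flatMap flat₆) t.next k₁ k₂ [] []

theorem encodeSymbol_eq (x : Symbol ℕ ℕ) : encodeSymbol x = flat₂ (symbolNode x) := by
  cases x <;> rfl

theorem runs_readOutput (l : List (Symbol ℕ ℕ)) (K : Node) (t : Tables) (rest : List ℕ) :
    ∃ K' : Node, Runs readOutput
      (tableStore (encodeList encodeSymbol l ++ rest) t [K.1] [K.2])
      (tableStore (0 :: rest) (scanOutput K l t) [K'.1] [K'.2]) (30 * l.length + 1) := by
  induction l generalizing K t with
  | nil => exact ⟨K, Runs.while_false (by simp [Test.Holds, tableStore, readStore, encodeList])⟩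
  | cons x l ih =>
    have h1 : Runs (block [.pop 0, .copy 0 12, .pop 0, .copy 0 13, .pop 0])
        (tableStore (encodeList encodeSymbol (x :: l) ++ rest) t [K.1] [K.2])
        (readStore (encodeList encodeSymbol l ++ rest) (t.unit.flatMap flat₄)
          (t.binary.flatMap flat₆) t.next [K.1] [K.2] [(symbolNode x).1] [(symbolNode x).2]) 6 := by
      refine Runs.block ?_ (ready_readStore ..)
      simp [Instr.run, tableStore, encodeList, encodeSymbol_eq, flat₂, update_readStore_0,
        update_readStore_12, update_readStore_13, readStore_0, readStore_12, readStore_13]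
    have hb : Test.Holds (.sameTop 0 4)
        (tableStore (encodeList encodeSymbol (x :: l) ++ rest) t [K.1] [K.2]) := by
      simp [Test.Holds, tableStore, readStore, encodeList]
    cases l with
    | nil =>
      obtain ⟨K', h3⟩ := ih K (scanOutput K [x] t)
      refine ⟨K', (Runs.while_true hb (h1.seq (Runs.ite_false (t := 7) ?_ ?_)) h3).mono ?_⟩
      · simp [Test.Holds, readStore, encodeList]
      · refine Runs.block ?_ (ready_readStore ..)
        simp [Instr.run, tableStore, scanOutput, flat₄, update_readStore_5,
          update_readStore_12, update_readStore_13, readStore_5, readStore_12, readStore_13,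
          readStore_10, readStore_11]
      · simp
    | cons y l =>
      obtain ⟨K', h3⟩ := ih (2, t.next)
        ⟨t.next + 1, t.unit, (K, symbolNode x, (2, t.next)) :: t.binary⟩
      refine ⟨K', (Runs.while_true hb (h1.seq (Runs.ite_true (t := 14) ?_ ?_)) h3).mono ?_⟩
      · simp [Test.Holds, readStore, encodeList]
      · refine Runs.block ?_ (ready_readStore ..)
        simp [Instr.run, tableStore, flat₆, update_readStore_6, update_readStore_9,
          update_readStore_10, update_readStore_11, update_readStore_12, update_readStore_13,
          readStore_6, readStore_9, readStore_12, readStore_13, readStore_10, readStore_11]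
      · simp only [List.length_cons]
        omega

theorem runs_readProds (ps : List (ContextFreeRule ℕ ℕ)) (t : Tables) (rest : List ℕ) :
    Runs readProds (tableStore (encodeList encodeRule ps ++ rest) t [] [])
      (tableStore (0 :: rest) (scanProds ps t) [] [])
      (30 * (ps.map fun p => 1 + p.output.length).sum + 1) := by
  induction ps generalizing t with
  | nil => exact Runs.while_false (by simp [Test.Holds, tableStore, readStore, encodeList])
  | cons p ps ih =>
    have hb : Test.Holds (.sameTop 0 4)
        (tableStore (encodeList encodeRule (p :: ps) ++ rest) t [] []) := by
      simp [Test.Holds, tableStore, readStore, encodeList]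
    have h1 : Runs (block [.pop 0, .push 10 1, .copy 0 11, .pop 0])
        (tableStore (encodeList encodeRule (p :: ps) ++ rest) t [] [])
        (tableStore (encodeList encodeSymbol p.output ++ (encodeList encodeRule ps ++ rest)) t
          [1] [p.input]) 5 := by
      refine Runs.block ?_ (ready_readStore ..)
      simp [Instr.run, tableStore, encodeList, encodeRule, update_readStore_0,
        update_readStore_10, update_readStore_11, readStore_0, readStore_10, readStore_11]
    obtain ⟨K', h2⟩ := runs_readOutput p.output (1, p.input) t (encodeList encodeRule ps ++ rest)
    have h3 : Runs (block [.pop 0, .pop 10, .pop 11])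
        (tableStore (0 :: (encodeList encodeRule ps ++ rest))
          (scanOutput (1, p.input) p.output t) [K'.1] [K'.2])
        (tableStore (encodeList encodeRule ps ++ rest)
          (scanOutput (1, p.input) p.output t) [] []) 4 := by
      refine Runs.block ?_ (ready_readStore ..)
      simp [Instr.run, tableStore, update_readStore_0,
        update_readStore_10, update_readStore_11, readStore_0, readStore_10, readStore_11]
    refine (Runs.while_true hb (h1.seq (h2.seq h3)) (ih _)).mono ?_
    simp only [List.map_cons, List.sum_cons]
    omega

theorem runs_readGrammar (H : CFG) (rest : List ℕ) :
    Runs readGrammar (Function.update (fun _ => []) 0 (encodeGrammar H ++ rest))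
      (tableStore rest H.tables [] []) (30 * H.size + 12) := by
  have h1 : Runs (block [.push 4 1, .push 9 0, .copy 0 6, .push 6 1, .push 6 0, .push 6 3,
      .push 6 1, .push 6 3, .pop 0])
      (Function.update (fun _ => []) 0 (encodeGrammar H ++ rest))
      (tableStore (encodeList encodeRule H.prods ++ rest) ⟨0, [], [startTriple H]⟩ [] []) 10 := by
    refine Runs.block ?_ (ready_readStore ..)
    rw [List.foldl_cons, List.foldl_cons]
    have h0 : ∀ inp, Instr.run (.push 9 0) (Instr.run (.push 4 1)
        (Function.update (fun _ => []) 0 inp)) = readStore inp [] [] 0 [] [] [] [] := by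
      intro inp
      funext y
      by_cases h9 : y = 9
      · subst h9; rfl
      by_cases h4 : y = 4
      · subst h4; rfl
      by_cases h0 : y = 0
      · subst h0; rfl
      simp only [Instr.run, Function.update_apply, if_neg h9, if_neg h4, if_neg h0]
      unfold readStore
      split <;> first | rfl | contradiction
    rw [h0]
    simp [Instr.run, tableStore, encodeGrammar, flat₆, startTriple, update_readStore_0,
      update_readStore_6, readStore_0, readStore_6]
  refine (h1.seq ((runs_readProds H.prods _ rest).seq (Runs.instr (.pop 0) _))).cast ?_ ?_
  · simp only [Instr.run, tableStore, readStore_0, List.tail_cons, update_readStore_0]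
    rfl
  · rw [CFG.size]
    omega

/-! ### The size of the tables -/

theorem length_scanOutput (l : List (Symbol ℕ ℕ)) (K : Node) (t : Tables) :
    (scanOutput K l t).unit.length + (scanOutput K l t).binary.length =
      t.unit.length + t.binary.length + l.length := by
  induction l generalizing K t with
  | nil => rfl
  | cons x l ih =>
    cases l with
    | nil => simp only [scanOutput, List.length_cons, List.length_nil]; omega
    | cons y l =>
      rw [scanOutput, ih]
      simp only [List.length_cons]
      omega

theorem length_scanProds_le (ps : List (ContextFreeRule ℕ ℕ)) (t : Tables) :
    (scanProds ps t).unit.length + (scanProds ps t).binary.length ≤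
      t.unit.length + t.binary.length + (ps.map fun p => 1 + p.output.length).sum := by
  induction ps generalizing t with
  | nil => exact le_rfl
  | cons p ps ih =>
    refine (ih _).trans ?_
    rw [length_scanOutput, List.map_cons, List.sum_cons]
    omega

theorem CFG.length_tables_le (H : CFG) :
    H.tables.unit.length + H.tables.binary.length ≤ H.size + 1 := by
  have := length_scanProds_le H.prods ⟨0, [], [startTriple H]⟩
  rw [CFG.size, CFG.tables]
  simp only [List.length_nil, List.length_singleton] at this
  omega

/-! ### The reduction -/

/-- For each letter of the string on stack `0`, push the encoding of its domain on stack `7`. The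
letter is held in stack `8`. -/
def writeDomains : Prog :=
  .while (.sameTop 0 4)
    (block [.pop 0, .copy 0 8, .pop 0] ;; Expr.domainExpr.compile 7 ;; .instr (.pop 8))

/-- The program of the reduction. It tabulates the binary form of the grammar in the stacks `5` and
`6`, computes the productions of the normal form in stack `15`, and collects the output in reverse
on stack `7`. -/
def reduction : Prog :=
  readGrammar ;; Expr.greibachExpr.compile 14 ;; move 14 15 ;; Expr.grammarExpr.compile 7 ;;
    writeDomains ;; .instr (.push 7 0) ;; move 7 1

theorem pop_letter {σ : Store} (h8 : σ 8 = []) (inp out out' : List ℕ) (a : ℕ) :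
    Instr.run (.pop 8) (Function.update (Function.update (Function.update
      (Function.update σ 0 inp) 7 out) 8 [a]) 7 out') =
      Function.update (Function.update σ 0 inp) 7 out' := by
  funext y
  simp only [Instr.run, Function.update_apply]
  split_ifs <;> simp_all

theorem runs_writeDomains {p : ℕ → ℕ}
    (hp : Expr.domainExpr.CompilesWithin (fun x => x = 8 ∨ x = 15) 20 p) {t : Tables} {L : ℕ}
    (hL : (t.greibachRules.flatMap flat₆).length + 1 ≤ L) (σ : Store) (hσ : Ready σ)
    (h4 : σ 4 = [1]) (h8 : σ 8 = []) (h15 : σ 15 = t.greibachRules.flatMap flat₆)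
    (h20 : ∀ i, 20 ≤ i → σ i = []) (s out : List ℕ) :
    (s.flatMap fun a => 1 :: encodeString (t.letters a)).length ≤ s.length * p L ∧
    Runs writeDomains (Function.update (Function.update σ 0 (encodeString s)) 7 out)
      (Function.update (Function.update σ 0 [0]) 7
        ((s.flatMap fun a => 1 :: encodeString (t.letters a)).reverse ++ out))
      (s.length * (p L + 6) + 1) := by
  induction s generalizing out with
  | nil =>
    refine ⟨by simp, Runs.cast (Runs.while_false ?_) ?_ (by simp)⟩
    · simp [Test.Holds, h4, encodeString, encodeList]
    · simp [encodeString, encodeList]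
  | cons a s ih =>
    set σ₁ := Function.update (Function.update (Function.update σ 0 (encodeString s)) 7 out) 8 [a]
      with hσ₁
    have hR : Ready σ₁ := by
      refine ⟨?_, ?_⟩ <;> simp only [hσ₁, Function.update_apply] <;> norm_num
      exacts [hσ.1, hσ.2]
    have h1 : Runs (block [.pop 0, .copy 0 8, .pop 0])
        (Function.update (Function.update σ 0 (encodeString (a :: s))) 7 out) σ₁ 4 := by
      refine Runs.block ?_ hR
      funext y
      simp only [List.foldl_cons, List.foldl_nil, Instr.run, Function.update_apply, hσ₁]
      split_ifs <;> simp_all [encodeString, encodeList]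
    have v8 : σ₁ 8 = [a] := Function.update_self _ _ _
    have v15 : σ₁ 15 = t.greibachRules.flatMap flat₆ := by
      simpa [hσ₁, Function.update_apply] using h15
    have hdom := hp L σ₁ 7 (by
        rintro x (rfl | rfl)
        · rw [v8]; simp only [List.length_singleton]; omega
        · rw [v15]; omega) hR (fun i hi => by
        simp only [hσ₁]
        rw [Function.update_of_ne (by omega), Function.update_of_ne (by omega),
          Function.update_of_ne (by omega)]
        exact h20 i hi) (by norm_num) (by norm_num) (by norm_num)
    rw [Expr.RunsWithin, Expr.eval_domainExpr v8 v15] at hdom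
    obtain ⟨l2, h2⟩ := hdom
    set d := 1 :: encodeString (t.letters a) with hd
    obtain ⟨l3, h3⟩ := ih (d.reverse ++ out)
    have h4' : Test.Holds (.sameTop 0 4)
        (Function.update (Function.update σ 0 (encodeString (a :: s))) 7 out) := by
      simp [Test.Holds, h4, encodeString, encodeList]
    have e1 : Instr.run (.pop 8) (Function.update σ₁ 7 (d.reverse ++ σ₁ 7)) =
        Function.update (Function.update σ 0 (encodeString s)) 7 (d.reverse ++ out) := by
      have v7 : σ₁ 7 = out := by simp [hσ₁]
      rw [v7, hσ₁]
      exact pop_letter h8 _ _ _ _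
    refine ⟨?_, ?_⟩
    · rw [List.flatMap_cons, List.length_append, ← hd,
        (List.length_cons : (a :: s).length = s.length + 1), Nat.succ_mul]
      omega
    · have h5 := Runs.instr (.pop 8) (Function.update σ₁ 7 (d.reverse ++ σ₁ 7))
      rw [e1] at h5
      refine (Runs.while_true h4' (h1.seq (h2.seq h5)) h3).cast ?_ ?_
      · rw [List.flatMap_cons, List.reverse_append, List.append_assoc]
      · rw [List.length_cons, Nat.succ_mul]
        omega

theorem encodeDomains_domains (H : CFG) (s : List ℕ) :
    encodeDomains (H.domains s) =
      (s.flatMap fun a => 1 :: encodeString (H.tables.letters a)) ++ [0] := by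
  have : List.ofFn (H.domains s) = s.map H.tables.letters := by
    conv_rhs => rw [← List.ofFn_get s, List.map_ofFn]
    rfl
  rw [encodeDomains, encodeList_eq, this, List.flatMap_map]

/-- The program computes the reduction in time polynomial in the size of the grammar and linear in
the length of the string. -/
theorem exists_reduction_computesWithin : ∃ q, Poly q ∧ ∀ (H : CFG) (s : List ℕ),
    reduction.ComputesWithin (encodeGrammar H ++ encodeString s)
      (encodeGrammar H.greibach ++ encodeDomains (H.domains s)) (q H.size * (s.length + 1)) := by
  obtain ⟨p₁, hp₁, h₁⟩ := Expr.exists_compilesWithin Expr.ok_greibachExpr (by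
    rintro x (rfl | rfl) <;> norm_num)
  obtain ⟨p₂, hp₂, h₂⟩ := Expr.exists_compilesWithin Expr.ok_grammarExpr (by
    rintro x (rfl | rfl) <;> norm_num)
  obtain ⟨p₃, hp₃, h₃⟩ := Expr.exists_compilesWithin Expr.ok_domainExpr (by
    rintro x (rfl | rfl) <;> norm_num)
  -- `L₁` bounds the lengths of the tables, `L₂` that of the list of productions.
  let L₁ : ℕ → ℕ := fun n => 6 * (n + 1)
  let L₂ : ℕ → ℕ := fun n => p₁ (L₁ n) + 1
  have hL₁ : Poly L₁ := (Poly.const 6).mul (Poly.id.add (Poly.const 1))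
  have hL₂ : Poly L₂ := (hp₁.comp hL₁).add (Poly.const 1)
  refine ⟨fun n => (30 * n + 40) + 5 * p₁ (L₁ n) + 5 * p₂ (L₂ n) + (5 * p₃ (L₂ n) + 6),
    ((((Poly.const 30).mul Poly.id).add (Poly.const 40)).add
      ((Poly.const 5).mul (hp₁.comp hL₁))).add ((Poly.const 5).mul (hp₂.comp hL₂)) |>.add
        (((Poly.const 5).mul (hp₃.comp hL₂)).add (Poly.const 6)), fun H s => ?_⟩
  set N := H.size
  set R := H.tables.greibachRules.flatMap flat₆ with hRdef
  set σ₁ := tableStore (encodeString s) H.tables [] [] with hσ₁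
  have r₁ : Runs readGrammar _ σ₁ _ := runs_readGrammar H (encodeString s)
  have hlen := H.length_tables_le
  have g := h₁ (L₁ N) σ₁ 14 (by
      have e5 : (σ₁ 5).length = H.tables.unit.length * 4 :=
        length_flatMap_of_length_eq length_flat₄ _
      have e6 : (σ₁ 6).length = H.tables.binary.length * 6 :=
        length_flatMap_of_length_eq length_flat₆ _
      rintro x (rfl | rfl) <;> simp only [L₁, N] <;> omega) (ready_readStore ..)
    (fun i hi => readStore_of_le _ _ _ _ _ _ _ _ (by omega)) (by norm_num) (by norm_num)
    (by norm_num)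
  rw [Expr.RunsWithin, Expr.eval_greibachExpr (t := H.tables) rfl rfl, ← hRdef] at g
  obtain ⟨lR, r₂⟩ := g
  have e14 : σ₁ 14 = [] := rfl
  have e15 : σ₁ 15 = [] := rfl
  rw [e14, List.append_nil] at r₂
  have hσ₁R : Ready σ₁ := ready_readStore ..
  have r₃ := Runs.move (x := 14) (y := 15) (by norm_num) (by norm_num) (by norm_num)
    (hσ₁R.update (i := 14) (by norm_num) R.reverse)
  set σ₂ := Function.update σ₁ 15 R with hσ₂
  have e2 : Function.update (Function.update (Function.update σ₁ 14 R.reverse) 14 []) 15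
      ((Function.update σ₁ 14 R.reverse 14).reverse ++ Function.update σ₁ 14 R.reverse 15) =
        σ₂ := by
    funext y
    simp only [hσ₂, Function.update_apply]
    split_ifs <;> simp_all
  rw [e2, Function.update_self, List.length_reverse] at r₃
  have hσ₂R : Ready σ₂ := hσ₁R.update (by norm_num) _
  have v4 : σ₂ 4 = [1] := rfl
  have v15 : σ₂ 15 = R := Function.update_self _ _ _
  have v20 : ∀ i, 20 ≤ i → σ₂ i = [] := fun i hi => by
    rw [hσ₂, Function.update_of_ne (by omega)]
    exact readStore_of_le _ _ _ _ _ _ _ _ (by omega)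
  have g := h₂ (L₂ N) σ₂ 7 (by
      rintro x (rfl | rfl)
      · rw [v4]; simp [L₂]
      · rw [v15]; exact lR.trans (Nat.le_succ _)) hσ₂R v20 (by norm_num) (by norm_num) (by norm_num)
  rw [Expr.RunsWithin, Expr.eval_grammarExpr (H := H) v4 v15] at g
  obtain ⟨lG, r₄⟩ := g
  set E := encodeGrammar H.greibach
  have r₅ := runs_writeDomains h₃ (t := H.tables) (L := L₂ N)
    (Nat.succ_le_succ lR) σ₂ hσ₂R v4 rfl v15 v20 s (E.reverse ++ [])
  obtain ⟨lD, r₅⟩ := r₅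
  set D := s.flatMap fun a => 1 :: encodeString (H.tables.letters a) with hD
  have e4 : Function.update (Function.update σ₂ 0 (encodeString s)) 7 (E.reverse ++ []) =
      Function.update σ₂ 7 (E.reverse ++ σ₂ 7) := by
    have : Function.update σ₂ 0 (encodeString s) = σ₂ := Function.update_eq_self 0 σ₂
    rw [this]
    rfl
  rw [e4] at r₅
  set σ₃ := Function.update (Function.update σ₂ 0 [0]) 7 (D.reverse ++ (E.reverse ++ [])) with hσ₃
  have r₆ := Runs.instr (.push 7 0) σ₃
  set σ₄ := Instr.run (.push 7 0) σ₃ with hσ₄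
  have hσ₄R : Ready σ₄ := by
    refine ⟨?_, ?_⟩ <;> simp only [hσ₄, hσ₃, Instr.run, Function.update_apply] <;> norm_num
    exacts [hσ₂R.1, hσ₂R.2]
  have v7 : σ₄ 7 = (E ++ (D ++ [0])).reverse := by
    simp [hσ₄, hσ₃, Instr.run]
  have v1 : σ₄ 1 = [] := rfl
  have r₇ := Runs.move (x := 7) (y := 1) (by norm_num) (by norm_num) (by norm_num) hσ₄R
  obtain ⟨t, ht, hex⟩ := r₁.seq (r₂.seq (r₃.seq (r₄.seq (r₅.seq (r₆.seq r₇)))))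
  refine ⟨_, t, hex, ?_, ht.trans ?_⟩
  · rw [Function.update_self, v7, v1, List.reverse_reverse, List.append_nil,
      encodeDomains_domains]
  · have l7 : (σ₄ 7).length = E.length + (D.length + 1) := by
      simp [v7, Nat.add_comm, Nat.add_left_comm]
    set n := s.length
    set X := 30 * N + 40 + 5 * p₁ (L₁ N) + 5 * p₂ (L₂ N) with hX
    have e5 : (X + (5 * p₃ (L₂ N) + 6)) * (n + 1) =
        X * n + X + 5 * (n * p₃ (L₂ N)) + n * 6 + (5 * p₃ (L₂ N) + 6) := by ring
    have e6 : n * (p₃ (L₂ N) + 6) = n * p₃ (L₂ N) + n * 6 := by ring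
    rw [e5]
    have : 0 ≤ X * n := Nat.zero_le _
    omega

/-- Any class of grammars that contains the simple ones admits the reduction. -/
theorem parsingReducesToDisentailment_of_isSimple {C : CFG → Prop}
    (hC : ∀ G : CFG, G.IsSimple → C G) : ParsingReducesToDisentailment C := by
  obtain ⟨q, ⟨c, k, hq⟩, h⟩ := exists_reduction_computesWithin
  refine ⟨reduction, c, k, CFG.greibach, CFG.domains, fun H s =>
    ⟨hC _ H.isSimple_greibach, H.mem_language_iff_not_disentailed s, ?_⟩⟩
  obtain ⟨σ, t, hex, hσ, ht⟩ := h H s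
  exact ⟨σ, t, hex, hσ, ht.trans (Nat.mul_le_mul_right _ (hq _))⟩

end GrammarDC

/-- Detecting disentailment of the grammar constraint for simple grammars, for deterministic
grammars and for LL(1) grammars is at least as hard as parsing with arbitrary context-free grammars,
up to reductions that are polynomial in the grammar size and linear in the string length. -/
theorem mainTheorem4 :
    GrammarDC.ParsingReducesToDisentailment GrammarDC.CFG.IsSimple ∧
    GrammarDC.ParsingReducesToDisentailment GrammarDC.CFG.IsDeterministic ∧
    GrammarDC.ParsingReducesToDisentailment GrammarDC.CFG.IsLL1 :=
  ⟨GrammarDC.parsingReducesToDisentailment_of_isSimple fun _ h => h,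
    GrammarDC.parsingReducesToDisentailment_of_isSimple fun _ h => h.isDeterministic,
    GrammarDC.parsingReducesToDisentailment_of_isSimple fun _ h => h.isLL1⟩
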